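/- Let $N\ge 1$ be an integer and let $\gamma,\alpha,\omega,p$ be real numbers with \[ \gamma>0,\qquad 0<\alpha<\min\{N,2\},\qquad \omega>\omega_0,\qquad 1<p<2^*-1, \] where $2^*=\infty$ if $N\in\{1,2\}$, $2^*=\dfrac{2N}{N-2}$ if $N\ge 3$, and \[ \omega_0:=-\inf\left\{\|\nabla v\|_{L^2}^2-\gamma\int_{\mathbb{R}^N}\frac{|v(x)|^2}{|x|^{\alpha}}\,dx \;\middle|\; v\in H^1(\mathbb{R}^N;\mathbb{C}),\ \|v\|_{L^2}=1\right\}. \] A positive solution is a function $\phi\in C([0,\infty))\cap C^2((0,\infty))$ with $\phi(r)>0$ for all $r\ge 0$ and \[ \phi''(r)+\frac{N-1}{r}\phi'(r)-\Bigl(\omega-\frac{\gamma}{r^{\alpha}}\Bigr)\phi(r)+\phi(r)^p=0\qquad\text{for all } r>0 . \] \begin{itemize} \item If $N\ge 2$, there is at most one positive solution $\phi$ with $\phi(r)\to 0$ as $r\to\infty$. \item If $N=1$, there is at most one positive solution $\phi$ with $\phi(r)\to 0$ as $r\to\infty$ and $\phi'(r)\to 0$ as $r\searrow 0$. \end{itemize}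 -/

import Mathlib

open MeasureTheory Filter Topology

noncomputable section

namespace InversePowerNLS

/-- `G` is the weak (distributional) gradient of `v : ℝ^N → ℂ`: for every real test function
`η ∈ C_c^∞(ℝ^N)` and every direction `i`, `∫ v ∂ᵢη = - ∫ Gᵢ η`. It is used below only for
`v`, `G` in `L²`, where all these integrals converge. -/
def IsWeakGradient {N : ℕ} (v : EuclideanSpace ℝ (Fin N) → ℂ)
    (G : EuclideanSpace ℝ (Fin N) → EuclideanSpace ℂ (Fin N)) : Prop :=
  ∀ η : EuclideanSpace ℝ (Fin N) → ℝ, ContDiff ℝ ((⊤ : ℕ∞) : WithTop ℕ∞) η → HasCompactSupport η →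
    ∀ i : Fin N,
      ∫ x, ((fderiv ℝ η x (EuclideanSpace.single i 1) : ℝ) : ℂ) * v x
        = - ∫ x, ((η x : ℝ) : ℂ) * G x i

/-- The set of values of the quadratic form `‖∇v‖² - γ ∫ |v|² / |x|^α` of the operator
`-Δ - γ |x|^{-α}` over all `v ∈ H¹(ℝ^N; ℂ)` with `‖v‖_{L²} = 1`. -/
def energyValues (N : ℕ) (γ α : ℝ) : Set ℝ :=
  {E : ℝ | ∃ (v : EuclideanSpace ℝ (Fin N) → ℂ)
      (G : EuclideanSpace ℝ (Fin N) → EuclideanSpace ℂ (Fin N)),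
      MemLp v 2 volume ∧ MemLp G 2 volume ∧ IsWeakGradient v G ∧
      ∫ x, ‖v x‖ ^ 2 = 1 ∧
      E = (∫ x, ‖G x‖ ^ 2) - γ * ∫ x, ‖v x‖ ^ 2 / ‖x‖ ^ α}

/-- `ω₀ = - inf (‖∇v‖² - γ ∫ |v|² / |x|^α)` over the `L²`-unit sphere of `H¹(ℝ^N)`. -/
def omegaZero (N : ℕ) (γ α : ℝ) : ℝ :=
  - sInf (energyValues N γ α)

/-- The Sobolev critical exponent `2^*`, with value `∞` for `N = 1, 2`. -/
def sobolevExponent (N : ℕ) : EReal :=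
  if N ≤ 2 then ⊤ else ((2 * (N : ℝ) / ((N : ℝ) - 2) : ℝ) : EReal)

/-- The standing assumptions on the parameters. -/
structure Assumptions (N : ℕ) (γ α ω p : ℝ) : Prop where
  one_le_N : 1 ≤ N
  gamma_pos : 0 < γ
  alpha_pos : 0 < α
  alpha_lt : α < min (N : ℝ) 2
  omega_gt : omegaZero N γ α < ω
  one_lt_p : 1 < p
  p_lt : (p : EReal) < sobolevExponent N - 1

/-- `φ` (restricted to `[0, ∞)`) is a positive solution, continuous on `[0, ∞)` and `C²` on
`(0, ∞)`, of `φ'' + ((N - 1) / r) φ' - (ω - γ / r^α) φ + φ^p = 0` for `r > 0`.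
The values of `φ` on `(-∞, 0)` play no role. -/
structure IsPositiveSolution (N : ℕ) (γ α ω p : ℝ) (φ : ℝ → ℝ) : Prop where
  continuousOn : ContinuousOn φ (Set.Ici 0)
  contDiffOn : ContDiffOn ℝ 2 φ (Set.Ioi 0)
  pos : ∀ r : ℝ, 0 ≤ r → 0 < φ r
  equation : ∀ r : ℝ, 0 < r →
    deriv (deriv φ) r + (((N : ℝ) - 1) / r) * deriv φ r
      - (ω - γ / r ^ α) * φ r + φ r ^ p = 0

end InversePowerNLS

end

namespace InversePowerNLS

/-! The proof compares two solutions through a generalized Pohožaev functional `J`. Its coefficients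
are tuned so that `J[φ]' = r^(k-3) D(r) φ²`, where the density `D` depends only on the parameters.
Subcriticality of `p` and the shape of `D` give `J[φ] ≥ 0` (`pohozaev_nonneg`).

Suppose `φ 0 < ψ 0` and set `w = ψ / φ`, `X = w² J[φ] - J[ψ]`. The densities cancel, leaving `X' = 2
w w' J[φ]`. The weighted Wronskian `W` has the sign of `w'`, and its own derivative has the sign of
`φ - ψ`. Hence `W` starts negative, and a first zero of `W` is excluded by the sign of `X` there
(`wronskian_neg`). So `w` decreases on the whole half-line and `X` is nonincreasing. As `X` is
asymptotically nonpositive at 0 and tends to 0 at infinity, it vanishes identically. Then `J[φ]` and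
`D` vanish too, which is impossible (`not_lt_at_zero`).

By symmetry the values at 0 agree, and uniqueness for the singular initial value problem
(`eq_of_eq_zero`) finishes the proof. The limits at infinity rest on exponential decay, which uses
`0 < ω`; this positivity follows from the existence of a decaying positive solution (`omega_pos`).
-/

/-! ### Monotonicity and integration of derivative bounds from the origin. -/

theorem antitoneOn_of_hasDerivAt_nonpos {f f' : ℝ → ℝ} {s : Set ℝ} (hs : Convex ℝ s)
    (hd : ∀ x ∈ s, HasDerivAt f (f' x) x) (h : ∀ x ∈ s, f' x ≤ 0) : AntitoneOn f s :=
  antitoneOn_of_hasDerivWithinAt_nonpos hs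
    (fun x hx => (hd x hx).continuousAt.continuousWithinAt)
    (fun x hx => (hd x (interior_subset hx)).hasDerivWithinAt)
    (fun x hx => h x (interior_subset hx))

theorem monotoneOn_of_hasDerivAt_nonneg {f f' : ℝ → ℝ} {s : Set ℝ} (hs : Convex ℝ s)
    (hd : ∀ x ∈ s, HasDerivAt f (f' x) x) (h : ∀ x ∈ s, 0 ≤ f' x) : MonotoneOn f s :=
  monotoneOn_of_hasDerivWithinAt_nonneg hs
    (fun x hx => (hd x hx).continuousAt.continuousWithinAt)
    (fun x hx => (hd x (interior_subset hx)).hasDerivWithinAt)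
    (fun x hx => h x (interior_subset hx))

/-- Keeping the exponent `q` unshifted leaves a single real power for `field_simp` to handle. -/
theorem hasDerivAt_rpow_div {x : ℝ} (hx : 0 < x) (q : ℝ) :
    HasDerivAt (fun y : ℝ => y ^ q) (q * x ^ q / x) x := by
  have := Real.hasDerivAt_rpow_const (x := x) (p := q) (Or.inl hx.ne')
  rwa [Real.rpow_sub_one hx.ne', ← mul_div_assoc] at this

theorem tendsto_rpow_nhdsGT_zero {q : ℝ} (hq : 0 < q) :
    Tendsto (fun s : ℝ => s ^ q) (𝓝[>] 0) (𝓝 0) := by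
  have := (Real.continuousAt_rpow_const 0 q (Or.inr hq.le)).tendsto.mono_left
    (nhdsWithin_le_nhds (s := Set.Ioi 0))
  rwa [Real.zero_rpow hq.ne'] at this

/-- If `f' ≤ g'` near the origin, `0 ≤ g` and `f` is frequently small there, then `f ≤ g`. -/
theorem le_of_hasDerivAt_le {f f' g g' : ℝ → ℝ} {R : ℝ}
    (hf : ∀ r ∈ Set.Ioc 0 R, HasDerivAt f (f' r) r)
    (hg : ∀ r ∈ Set.Ioc 0 R, HasDerivAt g (g' r) r)
    (hle : ∀ r ∈ Set.Ioc 0 R, f' r ≤ g' r) (hg0 : ∀ r ∈ Set.Ioc 0 R, 0 ≤ g r)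
    (h0 : ∀ δ > 0, ∃ᶠ r in 𝓝[>] (0 : ℝ), f r < δ) :
    ∀ r ∈ Set.Ioc 0 R, f r ≤ g r := by
  intro r₀ hr₀
  by_contra! hlt
  have hanti : AntitoneOn (fun r => f r - g r) (Set.Ioc 0 R) :=
    antitoneOn_of_hasDerivAt_nonpos (convex_Ioc 0 R) (fun r hr => (hf r hr).sub (hg r hr))
      (fun r hr => sub_nonpos.2 (hle r hr))
  -- As `f - g` is nonincreasing and `g ≥ 0`, `f` stays above `f r₀ - g r₀ > 0` all the way down to
  -- 0. This is why smallness of `f` along a sequence suffices.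
  refine h0 _ (sub_pos.2 hlt) ?_
  filter_upwards [Ioc_mem_nhdsGT hr₀.1] with r hr
  have hr' : r ∈ Set.Ioc 0 R := ⟨hr.1, hr.2.trans hr₀.2⟩
  have h1 := hanti hr' hr₀ hr.2
  have h2 := hg0 r hr'
  simp only at h1
  linarith

theorem abs_le_of_abs_hasDerivAt_le {f f' g g' : ℝ → ℝ} {R : ℝ}
    (hf : ∀ r ∈ Set.Ioc 0 R, HasDerivAt f (f' r) r)
    (hg : ∀ r ∈ Set.Ioc 0 R, HasDerivAt g (g' r) r)
    (hle : ∀ r ∈ Set.Ioc 0 R, |f' r| ≤ g' r) (hg0 : ∀ r ∈ Set.Ioc 0 R, 0 ≤ g r)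
    (h0 : ∀ δ > 0, ∃ᶠ r in 𝓝[>] (0 : ℝ), f r < δ)
    (h0' : ∀ δ > 0, ∃ᶠ r in 𝓝[>] (0 : ℝ), -f r < δ) :
    ∀ r ∈ Set.Ioc 0 R, |f r| ≤ g r := fun r hr => abs_le'.2
  ⟨le_of_hasDerivAt_le hf hg (fun r hr => (abs_le'.1 (hle r hr)).1) hg0 h0 r hr,
    le_of_hasDerivAt_le (f := fun r => -f r) (f' := fun r => -f' r) (fun r hr => (hf r hr).neg) hg
      (fun r hr => (abs_le'.1 (hle r hr)).2) hg0 h0' r hr⟩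

theorem frequently_lt_of_tendsto_zero {f : ℝ → ℝ} (h : Tendsto f (𝓝[>] 0) (𝓝 0)) :
    (∀ δ > 0, ∃ᶠ r in 𝓝[>] (0 : ℝ), f r < δ) ∧ ∀ δ > 0, ∃ᶠ r in 𝓝[>] (0 : ℝ), -f r < δ := by
  have h' := h.neg
  rw [neg_zero] at h'
  exact ⟨fun δ hδ => (h.eventually_lt_const hδ).frequently,
    fun δ hδ => (h'.eventually_lt_const hδ).frequently⟩

theorem abs_le_rpow_of_hasDerivAt_le {f f' : ℝ → ℝ} {M q R : ℝ} (hq : 0 < q) (hM : 0 ≤ M)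
    (hd : ∀ r ∈ Set.Ioc 0 R, HasDerivAt f (f' r) r)
    (hle : ∀ r ∈ Set.Ioc 0 R, |f' r| ≤ M * r ^ (q - 1))
    (hf : ∀ δ > 0, ∃ᶠ r in 𝓝[>] (0 : ℝ), f r < δ)
    (hf' : ∀ δ > 0, ∃ᶠ r in 𝓝[>] (0 : ℝ), -f r < δ) :
    ∀ r ∈ Set.Ioc 0 R, |f r| ≤ M / q * r ^ q := by
  refine abs_le_of_abs_hasDerivAt_le (g' := fun r => M * r ^ (q - 1)) hd (fun r hr => ?_) hle
    (fun r hr => ?_) hf hf'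
  · refine ((hasDerivAt_rpow_div hr.1 q).const_mul (M / q)).congr_deriv ?_
    rw [Real.rpow_sub_one hr.1.ne']
    field_simp
  · have := hr.1
    positivity

/-- A function bounded near the origin cannot have derivative at least `δ / r` there. -/
theorem not_eventually_div_le_deriv {f f' : ℝ → ℝ} {δ C : ℝ} (hδ : 0 < δ)
    (hC : ∀ᶠ r in 𝓝[>] (0 : ℝ), C ≤ f r)
    (hd : ∀ r > 0, HasDerivAt f (f' r) r) :
    ¬ ∀ᶠ r in 𝓝[>] (0 : ℝ), δ / r ≤ f' r := by
  intro h
  obtain ⟨r₀, hr₀, hsub⟩ := mem_nhdsGT_iff_exists_Ioc_subset.1 h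
  have hr₀' : (0 : ℝ) < r₀ := hr₀
  have hmono : MonotoneOn (fun r => f r - δ * Real.log r) (Set.Ioc 0 r₀) := by
    refine monotoneOn_of_hasDerivAt_nonneg (convex_Ioc 0 r₀)
      (f' := fun r => f' r - δ * r⁻¹) (fun r hr => ?_) (fun r hr => ?_)
    · exact (hd r hr.1).sub ((Real.hasDerivAt_log hr.1.ne').const_mul _)
    · have := hsub hr
      simp only [Set.mem_ofPred_eq, div_eq_mul_inv] at this
      linarith
  have hlog := Real.tendsto_log_nhdsGT_zero.eventually
    (eventually_lt_atBot ((C - (f r₀ - δ * Real.log r₀)) / δ))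
  obtain ⟨r, h1, h2, h3⟩ := (hlog.and (hC.and (Ioc_mem_nhdsGT hr₀'))).exists
  have h4 := hmono h3 ⟨hr₀', le_rfl⟩ h3.2
  rw [lt_div_iff₀ hδ] at h1
  simp only at h4
  linarith

/-! ### The equation in flux form and the behaviour of solutions at the origin. -/

variable {N : ℕ} {γ α ω p : ℝ} {φ ψ : ℝ → ℝ}

theorem IsPositiveSolution.hasDerivAt (hφ : IsPositiveSolution N γ α ω p φ) {r : ℝ} (hr : 0 < r) :
    HasDerivAt φ (deriv φ r) r :=
  ((hφ.contDiffOn.contDiffAt (Ioi_mem_nhds hr)).differentiableAt (by norm_num)).hasDerivAt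

theorem IsPositiveSolution.hasDerivAt_deriv (hφ : IsPositiveSolution N γ α ω p φ) {r : ℝ}
    (hr : 0 < r) :
    HasDerivAt (deriv φ)
      (-(((N : ℝ) - 1) / r) * deriv φ r + (ω - γ / r ^ α) * φ r - φ r ^ p) r := by
  have h1 : ContDiffOn ℝ 1 (deriv φ) (Set.Ioi 0) :=
    hφ.contDiffOn.deriv_of_isOpen isOpen_Ioi (by norm_num)
  have h2 := ((h1.contDiffAt (Ioi_mem_nhds hr)).differentiableAt (by norm_num)).hasDerivAt
  have h3 := hφ.equation r hr
  refine h2.congr_deriv ?_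
  linear_combination h3

/-- The radial flux `r^{N-1} φ'(r)`. -/
noncomputable def flux (N : ℕ) (φ : ℝ → ℝ) (r : ℝ) : ℝ := r ^ ((N : ℝ) - 1) * deriv φ r

theorem IsPositiveSolution.hasDerivAt_flux (hφ : IsPositiveSolution N γ α ω p φ) {r : ℝ}
    (hr : 0 < r) :
    HasDerivAt (flux N φ)
      (r ^ ((N : ℝ) - 1) * ((ω - γ / r ^ α) * φ r - φ r ^ p)) r := by
  refine ((hasDerivAt_rpow_div hr ((N : ℝ) - 1)).mul (hφ.hasDerivAt_deriv hr)).congr_deriv ?_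
  field_simp
  ring

theorem IsPositiveSolution.exists_bound (hφ : IsPositiveSolution N γ α ω p φ) (R : ℝ) :
    ∃ C > 0, ∀ r ∈ Set.Icc 0 R, φ r ≤ C := by
  obtain ⟨C, hC⟩ := (isCompact_Icc (a := (0 : ℝ)) (b := R)).exists_bound_of_continuousOn
    (hφ.continuousOn.mono Set.Icc_subset_Ici_self)
  refine ⟨max C 1, by positivity, fun r hr => ?_⟩
  exact (le_abs_self _).trans ((hC r hr).trans (le_max_left _ _))

theorem IsPositiveSolution.tendsto_zero (hφ : IsPositiveSolution N γ α ω p φ) :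
    Tendsto φ (𝓝[>] 0) (𝓝 (φ 0)) :=
  (hφ.continuousOn 0 Set.self_mem_Ici).mono_left (nhdsWithin_mono _ Set.Ioi_subset_Ici_self)

/-- Near 0 the singular potential dominates: multiplied by `r ^ α ≤ 1`, every term of the equation
is bounded. -/
theorem IsPositiveSolution.exists_flux_deriv_bound (hφ : IsPositiveSolution N γ α ω p φ)
    (hγ : 0 < γ) (hα : 0 < α) (hp : 1 < p) :
    ∃ M ≥ 0, ∀ r ∈ Set.Ioc (0 : ℝ) 1,
      |r ^ ((N : ℝ) - 1) * ((ω - γ / r ^ α) * φ r - φ r ^ p)| ≤ M * r ^ ((N : ℝ) - α - 1) := by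
  obtain ⟨C, hC, hb⟩ := hφ.exists_bound 1
  refine ⟨(|ω| + γ) * C + C ^ p, by positivity, fun r hr => ?_⟩
  have hr0 := hr.1
  have hrα : 0 < r ^ α := Real.rpow_pos_of_pos hr0 _
  have hrα1 : r ^ α ≤ 1 := Real.rpow_le_one hr0.le hr.2 hα.le
  have hφr := hφ.pos r hr0.le
  have hφC := hb r ⟨hr0.le, hr.2⟩
  have hsplit : r ^ ((N : ℝ) - α - 1) = r ^ ((N : ℝ) - 1) / r ^ α := by
    rw [← Real.rpow_sub hr0]; ring_nf
  rw [hsplit, abs_mul, abs_of_pos (Real.rpow_pos_of_pos hr0 _), mul_div_assoc', le_div_iff₀ hrα,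
    mul_comm _ (r ^ ((N : ℝ) - 1)), mul_assoc]
  refine mul_le_mul_of_nonneg_left ?_ (by positivity)
  rw [← abs_of_pos hrα, ← abs_mul, abs_of_pos hrα]
  have h1 : ((ω - γ / r ^ α) * φ r - φ r ^ p) * r ^ α
      = (ω * r ^ α - γ) * φ r - φ r ^ p * r ^ α := by field_simp
  rw [h1]
  refine (abs_sub _ _).trans (add_le_add ?_ ?_)
  · rw [abs_mul, abs_of_pos hφr]
    refine mul_le_mul ?_ hφC hφr.le (by positivity)
    refine (abs_sub _ _).trans ?_
    rw [abs_mul, abs_of_pos hrα, abs_of_pos hγ]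
    nlinarith [abs_nonneg ω]
  · rw [abs_of_pos (by positivity)]
    have h2 : φ r ^ p ≤ C ^ p := Real.rpow_le_rpow hφr.le hφC (by linarith)
    have h3 : 0 < C ^ p := by positivity
    nlinarith

/-- The condition at the origin that singles out regular solutions. -/
def RegularAtZero (N : ℕ) (φ : ℝ → ℝ) : Prop :=
  2 ≤ N ∨ N = 1 ∧ Tendsto (deriv φ) (𝓝[>] 0) (𝓝 0)

/-- For `N ≥ 2` a flux staying above `δ` near 0 would force `φ' ≥ δ r^(1-N) ≥ δ / r`, hence
logarithmic blow-up of the bounded function `φ`. For `N = 1` the flux is `φ'` itself. -/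
theorem IsPositiveSolution.frequently_flux_lt (hφ : IsPositiveSolution N γ α ω p φ)
    (h0 : RegularAtZero N φ) {δ : ℝ} (hδ : 0 < δ) :
    (∃ᶠ r in 𝓝[>] (0 : ℝ), flux N φ r < δ) ∧ ∃ᶠ r in 𝓝[>] (0 : ℝ), -flux N φ r < δ := by
  rcases h0 with hN | ⟨hN, hlim⟩
  · have key : ∀ x : ℝ, ∀ r ∈ Set.Ioc (0 : ℝ) 1, δ ≤ r ^ ((N : ℝ) - 1) * x → δ / r ≤ x := by
      intro x r hr h
      rw [div_le_iff₀ hr.1]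
      have h1 : r ^ ((N : ℝ) - 1) ≤ r := by
        conv_rhs => rw [← Real.rpow_one r]
        refine Real.rpow_le_rpow_of_exponent_ge hr.1 hr.2 ?_
        have : (2 : ℝ) ≤ N := by exact_mod_cast hN
        linarith
      have h2 := Real.rpow_pos_of_pos hr.1 ((N : ℝ) - 1)
      have hx : 0 < x := pos_of_mul_pos_right (hδ.trans_le h) h2.le
      nlinarith
    constructor
    · intro h
      refine not_eventually_div_le_deriv hδ (C := 0) ?_ (fun r hr => hφ.hasDerivAt hr) ?_
      · filter_upwards [self_mem_nhdsWithin] with r hr using (hφ.pos r (le_of_lt hr)).le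
      · filter_upwards [h, Ioc_mem_nhdsGT one_pos] with r h1 h2
        exact key _ r h2 (not_lt.1 h1)
    · intro h
      obtain ⟨C, -, hC⟩ := hφ.exists_bound 1
      refine not_eventually_div_le_deriv hδ (C := -C) (f := fun r => -φ r)
        (f' := fun r => -deriv φ r) ?_ (fun r hr => (hφ.hasDerivAt hr).neg) ?_
      · filter_upwards [Ioc_mem_nhdsGT one_pos] with r hr
        exact neg_le_neg (hC r ⟨hr.1.le, hr.2⟩)
      · filter_upwards [h, Ioc_mem_nhdsGT one_pos] with r h1 h2
        refine key _ r h2 ?_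
        simp only [flux] at h1
        linarith
  · have hflux : flux N φ = deriv φ := by
      funext r
      simp [flux, hN]
    rw [hflux]
    exact ⟨(frequently_lt_of_tendsto_zero hlim).1 δ hδ, (frequently_lt_of_tendsto_zero hlim).2 δ hδ⟩

theorem IsPositiveSolution.exists_flux_bound (hφ : IsPositiveSolution N γ α ω p φ)
    (h0 : RegularAtZero N φ) (hγ : 0 < γ) (hα : 0 < α) (hαN : α < N) (hp : 1 < p) :
    ∃ K ≥ 0, ∀ r ∈ Set.Ioc (0 : ℝ) 1, |flux N φ r| ≤ K * r ^ ((N : ℝ) - α) := by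
  obtain ⟨M, hM, hb⟩ := hφ.exists_flux_deriv_bound hγ hα hp
  have hq : 0 < (N : ℝ) - α := by linarith
  exact ⟨M / (N - α), by positivity, abs_le_rpow_of_hasDerivAt_le hq hM
    (fun r hr => hφ.hasDerivAt_flux hr.1) hb
    (fun δ hδ => (hφ.frequently_flux_lt h0 hδ).1) (fun δ hδ => (hφ.frequently_flux_lt h0 hδ).2)⟩

theorem IsPositiveSolution.exists_deriv_bound (hφ : IsPositiveSolution N γ α ω p φ)
    (h0 : RegularAtZero N φ) (hγ : 0 < γ) (hα : 0 < α) (hαN : α < N) (hp : 1 < p) :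
    ∃ K ≥ 0, ∀ r ∈ Set.Ioc (0 : ℝ) 1, |deriv φ r| ≤ K * r ^ (1 - α) := by
  obtain ⟨K, hK, hb⟩ := hφ.exists_flux_bound h0 hγ hα hαN hp
  refine ⟨K, hK, fun r hr => ?_⟩
  have h1 := hb r hr
  have h2 := Real.rpow_pos_of_pos hr.1 ((N : ℝ) - 1)
  have h3 : r ^ ((N : ℝ) - α) = r ^ ((N : ℝ) - 1) * r ^ (1 - α) := by
    rw [← Real.rpow_add hr.1]; ring_nf
  rw [flux, abs_mul, abs_of_pos h2, h3, mul_left_comm] at h1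
  exact le_of_mul_le_mul_left h1 h2

theorem IsPositiveSolution.tendsto_flux (hφ : IsPositiveSolution N γ α ω p φ)
    (h0 : RegularAtZero N φ) (hγ : 0 < γ) (hα : 0 < α) (hαN : α < N) (hp : 1 < p) :
    Tendsto (flux N φ) (𝓝[>] 0) (𝓝 0) := by
  obtain ⟨K, hK, hb⟩ := hφ.exists_flux_bound h0 hγ hα hαN hp
  have h1 : Tendsto (fun r : ℝ => K * r ^ ((N : ℝ) - α)) (𝓝[>] 0) (𝓝 0) := by
    simpa using (tendsto_rpow_nhdsGT_zero (by linarith : 0 < (N : ℝ) - α)).const_mul K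
  refine squeeze_zero_norm' ?_ h1
  filter_upwards [Ioc_mem_nhdsGT one_pos] with r hr using hb r hr

/-! ### The Wronskian and the ratio of two solutions. -/

/-- The weighted Wronskian `r^{N-1} (ψ' φ - ψ φ')`. -/
noncomputable def wronskian (N : ℕ) (φ ψ : ℝ → ℝ) (r : ℝ) : ℝ :=
  flux N ψ r * φ r - ψ r * flux N φ r

/-- The linear part is in divergence form, so the frequency and the singular potential cancel and
only the nonlinearity survives. -/
theorem IsPositiveSolution.hasDerivAt_wronskian (hφ : IsPositiveSolution N γ α ω p φ)
    (hψ : IsPositiveSolution N γ α ω p ψ) {r : ℝ} (hr : 0 < r) :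
    HasDerivAt (wronskian N φ ψ)
      (r ^ ((N : ℝ) - 1) * (φ r ^ p * ψ r - ψ r ^ p * φ r)) r := by
  refine (((hψ.hasDerivAt_flux hr).mul (hφ.hasDerivAt hr)).sub
    ((hψ.hasDerivAt hr).mul (hφ.hasDerivAt_flux hr))).congr_deriv ?_
  simp only [flux]
  ring

theorem IsPositiveSolution.hasDerivAt_div (hφ : IsPositiveSolution N γ α ω p φ)
    (hψ : IsPositiveSolution N γ α ω p ψ) {r : ℝ} (hr : 0 < r) :
    HasDerivAt (fun r => ψ r / φ r)
      (wronskian N φ ψ r / (r ^ ((N : ℝ) - 1) * φ r ^ 2)) r := by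
  have h1 := (Real.rpow_pos_of_pos hr ((N : ℝ) - 1)).ne'
  have h2 := (hφ.pos r hr.le).ne'
  refine ((hψ.hasDerivAt hr).div (hφ.hasDerivAt hr) h2).congr_deriv ?_
  simp only [flux, wronskian]
  field_simp

theorem IsPositiveSolution.tendsto_wronskian (hφ : IsPositiveSolution N γ α ω p φ)
    (hψ : IsPositiveSolution N γ α ω p ψ) (hφ0 : RegularAtZero N φ) (hψ0 : RegularAtZero N ψ)
    (hγ : 0 < γ) (hα : 0 < α) (hαN : α < N) (hp : 1 < p) :
    Tendsto (wronskian N φ ψ) (𝓝[>] 0) (𝓝 0) := by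
  have h := ((hψ.tendsto_flux hψ0 hγ hα hαN hp).mul hφ.tendsto_zero).sub
    (hψ.tendsto_zero.mul (hφ.tendsto_flux hφ0 hγ hα hαN hp))
  simp only [zero_mul, mul_zero, sub_zero] at h
  exact h

/-! ### Uniqueness for the singular initial value problem. -/

theorem abs_rpow_sub_rpow_le {C x y : ℝ} (hp : 1 < p) (hx : x ∈ Set.Icc 0 C)
    (hy : y ∈ Set.Icc 0 C) : |x ^ p - y ^ p| ≤ p * C ^ (p - 1) * |x - y| := by
  refine (convex_Icc (0 : ℝ) C).norm_image_sub_le_of_norm_hasDerivWithin_le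
    (f' := fun z => p * z ^ (p - 1))
    (fun z _ => (Real.hasDerivAt_rpow_const (Or.inr hp.le)).hasDerivWithinAt)
    (fun z hz => ?_) hy hx
  rw [Real.norm_eq_abs, abs_of_nonneg (mul_nonneg (by linarith) (Real.rpow_nonneg hz.1 _))]
  exact mul_le_mul_of_nonneg_left (Real.rpow_le_rpow hz.1 hz.2 (by linarith)) (by linarith)

theorem IsPositiveSolution.exists_pos_bound (hφ : IsPositiveSolution N γ α ω p φ) {R : ℝ}
    (hR : 0 ≤ R) : ∃ c > 0, ∀ r ∈ Set.Icc 0 R, c ≤ φ r := by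
  obtain ⟨r₀, hr₀, h⟩ := (isCompact_Icc (a := (0 : ℝ)) (b := R)).exists_isMinOn
    ⟨0, le_rfl, hR⟩ (hφ.continuousOn.mono Set.Icc_subset_Ici_self)
  exact ⟨φ r₀, hφ.pos _ hr₀.1, fun r hr => h hr⟩

theorem IsPositiveSolution.continuousOn_div (hφ : IsPositiveSolution N γ α ω p φ)
    (hψ : IsPositiveSolution N γ α ω p ψ) : ContinuousOn (fun r => ψ r / φ r) (Set.Ici 0) :=
  hψ.continuousOn.div hφ.continuousOn (fun r hr => (hφ.pos r hr).ne')

/-- Bounds the Wronskian's derivative by the deviation of the ratio from 1, which closes a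
Gronwall-type loop between the two. -/
theorem IsPositiveSolution.exists_lipschitz_bound (hφ : IsPositiveSolution N γ α ω p φ)
    (hψ : IsPositiveSolution N γ α ω p ψ) (hp : 1 < p) (R : ℝ) :
    ∃ L > 0, ∀ r ∈ Set.Icc 0 R,
      |φ r ^ p * ψ r - ψ r ^ p * φ r| ≤ L * |ψ r / φ r - 1| := by
  obtain ⟨C₁, hC₁, h₁⟩ := hφ.exists_bound R
  obtain ⟨C₂, hC₂, h₂⟩ := hψ.exists_bound R
  set C := max C₁ C₂ with hCdef
  have hC : 0 < C := lt_max_of_lt_left hC₁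
  refine ⟨(C ^ p + C * (p * C ^ (p - 1))) * C, by positivity, fun r hr => ?_⟩
  have hφ0 := hφ.pos r hr.1
  have hψ0 := hψ.pos r hr.1
  have hφC : φ r ≤ C := (h₁ r hr).trans (le_max_left _ _)
  have hψC : ψ r ≤ C := (h₂ r hr).trans (le_max_right _ _)
  have hsub : |ψ r - φ r| ≤ C * |ψ r / φ r - 1| := by
    have : ψ r - φ r = φ r * (ψ r / φ r - 1) := by field_simp
    rw [this, abs_mul, abs_of_pos hφ0]
    gcongr
  have h3 : φ r ^ p * ψ r - ψ r ^ p * φ r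
      = φ r ^ p * (ψ r - φ r) - φ r * (ψ r ^ p - φ r ^ p) := by ring
  calc |φ r ^ p * ψ r - ψ r ^ p * φ r|
      ≤ φ r ^ p * |ψ r - φ r| + φ r * |ψ r ^ p - φ r ^ p| := by
        rw [h3]
        refine (abs_sub _ _).trans ?_
        rw [abs_mul, abs_mul, abs_of_pos hφ0, abs_of_pos (Real.rpow_pos_of_pos hφ0 p)]
    _ ≤ C ^ p * |ψ r - φ r| + C * (p * C ^ (p - 1) * |ψ r - φ r|) := by
        gcongr
        exact abs_rpow_sub_rpow_le hp ⟨hψ0.le, hψC⟩ ⟨hφ0.le, hφC⟩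
    _ = (C ^ p + C * (p * C ^ (p - 1))) * |ψ r - φ r| := by ring
    _ ≤ (C ^ p + C * (p * C ^ (p - 1))) * (C * |ψ r / φ r - 1|) := by gcongr
    _ = _ := by ring

/-- Two regular positive solutions with the same initial value coincide. -/
theorem IsPositiveSolution.eq_of_eq_zero (hφ : IsPositiveSolution N γ α ω p φ)
    (hψ : IsPositiveSolution N γ α ω p ψ) (hφ0 : RegularAtZero N φ) (hψ0 : RegularAtZero N ψ)
    (hγ : 0 < γ) (hα : 0 < α) (hαN : α < N) (hp : 1 < p) (hN : 1 ≤ N) (h0 : φ 0 = ψ 0) :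
    ∀ R : ℝ, 0 ≤ R → φ R = ψ R := by
  intro R hR
  obtain ⟨L, hL, hLb⟩ := hφ.exists_lipschitz_bound hψ hp R
  obtain ⟨c, hc, hcb⟩ := hφ.exists_pos_bound hR
  -- Two integrations cost a factor `L / (c² l²) = (l - 1) / l² < 1` in the sup norm weighted by
  -- `exp (-l r)`. The weighted maximum `K` of `|u|` is thus at most a proper fraction of itself.
  set l : ℝ := L / c ^ 2 + 1 with hl
  have hl0 : 0 < l := by positivity
  set u : ℝ → ℝ := fun r => ψ r / φ r - 1 with hu
  have hu0 : u 0 = 0 := by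
    simp [hu, ← h0, div_self (hφ.pos 0 le_rfl).ne']
  have hucont : ContinuousOn u (Set.Ici 0) := (hφ.continuousOn_div hψ).sub continuousOn_const
  obtain ⟨r₀, hr₀, hmax⟩ := (isCompact_Icc (a := (0 : ℝ)) (b := R)).exists_isMaxOn
    (f := fun r => |u r| / Real.exp (l * r)) ⟨0, le_rfl, hR⟩
    ((hucont.mono Set.Icc_subset_Ici_self).abs.div (by fun_prop) fun _ _ => (Real.exp_pos _).ne')
  set K := |u r₀| / Real.exp (l * r₀) with hK
  have hK0 : 0 ≤ K := by positivity
  have hub : ∀ r ∈ Set.Icc 0 R, |u r| ≤ K * Real.exp (l * r) := fun r hr =>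
    (div_le_iff₀ (Real.exp_pos _)).1 (hmax hr)
  have hexp : ∀ r : ℝ, HasDerivAt (fun r => Real.exp (l * r)) (l * Real.exp (l * r)) r := by
    intro r
    refine ((hasDerivAt_id r).const_mul l).exp.congr_deriv ?_
    simp; ring
  have hN' : (0 : ℝ) ≤ (N : ℝ) - 1 := by
    have : (1 : ℝ) ≤ N := by exact_mod_cast hN
    linarith
  have hW : ∀ r ∈ Set.Ioc 0 R,
      |wronskian N φ ψ r| ≤ L * K / l * (r ^ ((N : ℝ) - 1) * Real.exp (l * r)) := by
    have hlim := frequently_lt_of_tendsto_zero (hφ.tendsto_wronskian hψ hφ0 hψ0 hγ hα hαN hp)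
    refine abs_le_of_abs_hasDerivAt_le (fun r hr => hφ.hasDerivAt_wronskian hψ hr.1)
      (fun r hr => ((hasDerivAt_rpow_div hr.1 _).mul (hexp r)).const_mul _) (fun r hr => ?_)
      (fun r hr => ?_) hlim.1 hlim.2
    · have hr0 := hr.1
      have hr' : r ∈ Set.Icc 0 R := ⟨hr.1.le, hr.2⟩
      have h1 : |φ r ^ p * ψ r - ψ r ^ p * φ r| ≤ L * (K * Real.exp (l * r)) :=
        (hLb r hr').trans (by gcongr; exact hub r hr')
      -- Differentiating the power in the majorant gives a nonnegative term, which is discarded.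
      have h2 : 0 ≤ ((N : ℝ) - 1) * r ^ ((N : ℝ) - 1) / r * Real.exp (l * r) := by positivity
      have h3 : 0 ≤ L * K / l := by positivity
      rw [abs_mul, abs_of_pos (Real.rpow_pos_of_pos hr0 _)]
      calc r ^ ((N : ℝ) - 1) * |φ r ^ p * ψ r - ψ r ^ p * φ r|
          ≤ r ^ ((N : ℝ) - 1) * (L * (K * Real.exp (l * r))) := by gcongr
        _ = L * K / l * (r ^ ((N : ℝ) - 1) * (l * Real.exp (l * r))) := by field_simp
        _ ≤ _ := by gcongr; linarith
    · have hr0 := hr.1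
      positivity
  have hu1 : ∀ r ∈ Set.Ioc 0 R, |u r| ≤ L * K / (l ^ 2 * c ^ 2) * Real.exp (l * r) := by
    have hlim : Tendsto u (𝓝[>] 0) (𝓝 0) := by
      have := (hucont 0 Set.self_mem_Ici).mono_left
        (nhdsWithin_mono _ (Set.Ioi_subset_Ici_self (a := (0 : ℝ))))
      rwa [hu0] at this
    have hlim := frequently_lt_of_tendsto_zero hlim
    refine abs_le_of_abs_hasDerivAt_le (fun r hr => (hφ.hasDerivAt_div hψ hr.1).sub_const 1)
      (fun r hr => (hexp r).const_mul _) (fun r hr => ?_) (fun r hr => by positivity)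
      hlim.1 hlim.2
    have hr0 := hr.1
    have hr1 := Real.rpow_pos_of_pos hr0 ((N : ℝ) - 1)
    have hcφ := hcb r ⟨hr.1.le, hr.2⟩
    rw [abs_div, abs_of_pos (a := r ^ ((N : ℝ) - 1) * φ r ^ 2) (by
      have := hφ.pos r hr0.le
      positivity)]
    calc |wronskian N φ ψ r| / (r ^ ((N : ℝ) - 1) * φ r ^ 2)
        ≤ L * K / l * (r ^ ((N : ℝ) - 1) * Real.exp (l * r)) / (r ^ ((N : ℝ) - 1) * c ^ 2) := by
          gcongr
          exact hW r hr
      _ = _ := by field_simp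
  have hKzero : K = 0 := by
    rcases hr₀.1.eq_or_lt with h | h
    · rw [hK, ← h, hu0]; simp
    · have h1 : K ≤ L * K / (l ^ 2 * c ^ 2) := by
        rw [hK, div_le_iff₀ (Real.exp_pos _)]
        exact hu1 r₀ ⟨h, hr₀.2⟩
      have h2 : L * K / (l ^ 2 * c ^ 2) = L / c ^ 2 * K / l ^ 2 := by field_simp
      rw [h2, le_div_iff₀ (by positivity)] at h1
      have h3 : L / c ^ 2 = l - 1 := by rw [hl]; ring
      rw [h3] at h1
      have h4 : 1 ≤ l := by
        have : 0 ≤ L / c ^ 2 := by positivity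
        linarith
      nlinarith [mul_nonneg hK0 (by nlinarith : 0 ≤ l ^ 2 - l)]
  have h5 := hub R ⟨hR, le_rfl⟩
  rw [hKzero, zero_mul] at h5
  have h6 : ψ R / φ R - 1 = 0 := abs_eq_zero.1 (le_antisymm h5 (abs_nonneg _))
  have h7 := hφ.pos R hR
  field_simp at h6
  linarith

/-! ### Positivity of the frequency and decay at infinity. -/

theorem IsPositiveSolution.exists_deriv_neg (hφ : IsPositiveSolution N γ α ω p φ)
    (hlim : Tendsto φ atTop (𝓝 0)) {a : ℝ} (ha : 0 < a) : ∃ r ≥ a, deriv φ r < 0 := by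
  by_contra! h
  have hmono : MonotoneOn φ (Set.Ici a) :=
    monotoneOn_of_hasDerivAt_nonneg (convex_Ici a)
      (fun r hr => hφ.hasDerivAt (ha.trans_le hr)) (fun r hr => h r hr)
  have h1 : φ a ≤ 0 := ge_of_tendsto hlim (by
    filter_upwards [eventually_ge_atTop a] with r hr using hmono Set.self_mem_Ici hr hr)
  exact absurd (hφ.pos a ha.le) (not_lt.2 h1)

/-- A decaying positive solution can exist only for positive frequencies. -/
theorem IsPositiveSolution.omega_pos (hφ : IsPositiveSolution N γ α ω p φ) (hγ : 0 < γ)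
    (hα2 : α < 2) (hαN : α < N) (hN : 1 ≤ N) (hlim : Tendsto φ atTop (𝓝 0)) : 0 < ω := by
  by_contra! hω
  have hN1 : (1 : ℝ) ≤ N := by exact_mod_cast hN
  set q : ℝ := (N : ℝ) - α with hq
  have hq0 : 0 < q := by linarith
  have hflux' : ∀ r > 0, r ^ ((N : ℝ) - 1) * ((ω - γ / r ^ α) * φ r - φ r ^ p)
      ≤ -(γ * φ r * (r ^ q / r)) := by
    intro r hr
    have h1 := hφ.pos r hr.le
    have h2 : r ^ q / r = r ^ ((N : ℝ) - 1) / r ^ α := by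
      rw [← Real.rpow_sub hr, ← Real.rpow_sub_one hr.ne', hq]; ring_nf
    have h3 : 0 < φ r ^ p := Real.rpow_pos_of_pos h1 _
    have h4 : 0 < r ^ ((N : ℝ) - 1) := Real.rpow_pos_of_pos hr _
    have h5 : ω * φ r ≤ 0 := mul_nonpos_of_nonpos_of_nonneg hω h1.le
    rw [h2]
    have h6 : -(γ * φ r * (r ^ ((N : ℝ) - 1) / r ^ α))
        = r ^ ((N : ℝ) - 1) * (-(γ / r ^ α) * φ r) := by ring
    rw [h6]
    refine mul_le_mul_of_nonneg_left ?_ h4.le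
    linarith
  have hanti : AntitoneOn (flux N φ) (Set.Ioi 0) :=
    antitoneOn_of_hasDerivAt_nonpos (convex_Ioi 0) (fun r hr => hφ.hasDerivAt_flux hr)
      (fun r hr => (hflux' r hr).trans (by
        have := hφ.pos r (le_of_lt hr)
        have hr' : 0 < r := hr
        rw [neg_nonpos]
        positivity))
  obtain ⟨a, ha1, hda⟩ := hφ.exists_deriv_neg hlim one_pos
  have ha : 0 < a := by linarith
  set δ : ℝ := -flux N φ a with hδ
  have hδ0 : 0 < δ := by
    have := Real.rpow_pos_of_pos ha ((N : ℝ) - 1)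
    rw [hδ, flux]
    nlinarith
  have hfluxa : ∀ r ≥ a, flux N φ r ≤ -δ := fun r hr => by
    have := hanti (Set.mem_Ioi.2 ha) (Set.mem_Ioi.2 (ha.trans_le hr)) hr
    linarith
  -- The flux bound gives `-δ r^(1-N)`. It is weakened to `-δ r^(-N-1)`, integrable at infinity in
  -- every dimension, so that `φ` is bounded below by a multiple of `r^(-N)`.
  have hderiv : ∀ r ≥ a, deriv φ r ≤ -(δ * (r ^ (-(N : ℝ)) / r)) := by
    intro r hr
    have hr0 : 0 < r := ha.trans_le hr
    have h1 := hfluxa r hr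
    have h2 : r ^ (-(N : ℝ)) / r * r ^ ((N : ℝ) - 1) ≤ 1 := by
      rw [← Real.rpow_sub_one hr0.ne', ← Real.rpow_add hr0]
      exact Real.rpow_le_one_of_one_le_of_nonpos (ha1.trans hr) (by linarith)
    have h3 : 0 < r ^ ((N : ℝ) - 1) := Real.rpow_pos_of_pos hr0 _
    rw [flux] at h1
    by_contra! h4
    have h5 := mul_lt_mul_of_pos_left h4 h3
    nlinarith
  have hφanti : AntitoneOn φ (Set.Ici a) :=
    antitoneOn_of_hasDerivAt_nonpos (convex_Ici a) (fun r hr => hφ.hasDerivAt (ha.trans_le hr))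
      (fun r hr => (hderiv r hr).trans (by
        have hr' : 0 < r := ha.trans_le hr
        rw [neg_nonpos]
        positivity))
  have hlow : ∀ r ≥ a, δ / N * r ^ (-(N : ℝ)) ≤ φ r := by
    intro r hr
    have h1 : AntitoneOn (fun r => φ r - δ / N * r ^ (-(N : ℝ))) (Set.Ici a) := by
      refine antitoneOn_of_hasDerivAt_nonpos (convex_Ici a)
        (fun r hr => (hφ.hasDerivAt (ha.trans_le hr)).sub
          ((hasDerivAt_rpow_div (ha.trans_le hr) _).const_mul _)) (fun r hr => ?_)
      have h2 := hderiv r hr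
      have h3 : δ / N * (-(N : ℝ) * r ^ (-(N : ℝ)) / r) = -(δ * (r ^ (-(N : ℝ)) / r)) := by
        field_simp
      rw [h3]
      linarith
    have h2 : Tendsto (fun r => φ r - δ / N * r ^ (-(N : ℝ))) atTop (𝓝 0) := by
      have := hlim.sub ((tendsto_rpow_neg_atTop (by linarith : (0 : ℝ) < N)).const_mul (δ / N))
      simpa using this
    have h3 := le_of_tendsto h2 (by
      filter_upwards [eventually_ge_atTop r] with s hs using h1 hr (le_trans hr hs) hs)
    linarith
  -- The potential term is integrated from `a` to `r`, with `φ s ≥ φ r` on that interval.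
  have hup : ∀ r ≥ a, flux N φ r ≤ -(γ * φ r / q * (r ^ q - a ^ q)) := by
    intro r hr
    have h1 : AntitoneOn (fun s => flux N φ s + γ * φ r / q * s ^ q) (Set.Icc a r) := by
      refine antitoneOn_of_hasDerivAt_nonpos (convex_Icc a r)
        (fun s hs => (hφ.hasDerivAt_flux (ha.trans_le hs.1)).add
          ((hasDerivAt_rpow_div (ha.trans_le hs.1) _).const_mul _)) (fun s hs => ?_)
      have hs0 : 0 < s := ha.trans_le hs.1
      have h2 := hflux' s hs0
      have h3 : γ * φ r / q * (q * s ^ q / s) = γ * φ r * (s ^ q / s) := by field_simp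
      have h4 : γ * φ r * (s ^ q / s) ≤ γ * φ s * (s ^ q / s) := by
        have := hφanti hs.1 hr hs.2
        gcongr
      rw [h3]
      linarith
    have h2 := h1 ⟨le_rfl, hr⟩ ⟨hr, le_rfl⟩ hr
    have h3 := hfluxa a le_rfl
    simp only at h2
    linarith
  -- Thresholds forcing `r φ' / φ ≤ -(N + 1)`. The resulting decay like `r^(-N-1)` contradicts the
  -- lower bound of order `r^(-N)`.
  have hbig : ∀ᶠ r : ℝ in atTop, 2 * a ^ q ≤ r ^ q ∧ ((N : ℝ) + 1) * (2 * q / γ) ≤ r ^ (2 - α) :=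
    ((tendsto_rpow_atTop hq0).eventually_ge_atTop _).and
      ((tendsto_rpow_atTop (by linarith : 0 < 2 - α)).eventually_ge_atTop _)
  obtain ⟨b, hb⟩ := eventually_atTop.1 hbig
  set d := max a b with hd
  have hda : a ≤ d := le_max_left _ _
  have hlog : ∀ r ≥ d, r * deriv φ r ≤ -(((N : ℝ) + 1) * φ r) := by
    intro r hr
    have hra : a ≤ r := hda.trans hr
    have hr0 : 0 < r := ha.trans_le hra
    have hφr := hφ.pos r hr0.le
    obtain ⟨h1, h2⟩ := hb r ((le_max_right _ _).trans hr)
    have h3 := hup r hra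
    have h4 : γ * φ r / q * (r ^ q / 2) ≤ γ * φ r / q * (r ^ q - a ^ q) := by
      gcongr
      linarith
    have h5 : r ^ q * r = r ^ ((N : ℝ) - 1) * r ^ (2 - α) := by
      rw [← Real.rpow_add_one hr0.ne', ← Real.rpow_add hr0, hq]; ring_nf
    have h6 : 0 < r ^ ((N : ℝ) - 1) := Real.rpow_pos_of_pos hr0 _
    have h7 : r ^ ((N : ℝ) - 1) * (r * deriv φ r)
        ≤ r ^ ((N : ℝ) - 1) * -(γ * φ r / (2 * q) * r ^ (2 - α)) := by
      calc r ^ ((N : ℝ) - 1) * (r * deriv φ r) = flux N φ r * r := by rw [flux]; ring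
        _ ≤ -(γ * φ r / q * (r ^ q / 2)) * r := by gcongr; linarith
        _ = -(γ * φ r / (2 * q) * (r ^ q * r)) := by field_simp
        _ = _ := by rw [h5]; ring
    have h8 := le_of_mul_le_mul_left h7 h6
    have h9 : γ * φ r / (2 * q) * (((N : ℝ) + 1) * (2 * q / γ))
        ≤ γ * φ r / (2 * q) * r ^ (2 - α) := by gcongr
    have h10 : γ * φ r / (2 * q) * (((N : ℝ) + 1) * (2 * q / γ)) = ((N : ℝ) + 1) * φ r := by
      field_simp
    linarith
  have hdec : AntitoneOn (fun r => φ r * r ^ ((N : ℝ) + 1)) (Set.Ici d) := by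
    have hd0 : 0 < d := ha.trans_le hda
    refine antitoneOn_of_hasDerivAt_nonpos (convex_Ici d)
      (fun r hr => (hφ.hasDerivAt (hd0.trans_le hr)).mul
        (hasDerivAt_rpow_div (hd0.trans_le hr) _)) (fun r hr => ?_)
    have hr0 : 0 < r := hd0.trans_le hr
    have h1 := hlog r hr
    have h2 : deriv φ r * r ^ ((N : ℝ) + 1) + φ r * (((N : ℝ) + 1) * r ^ ((N : ℝ) + 1) / r)
        = (r * deriv φ r + ((N : ℝ) + 1) * φ r) * (r ^ ((N : ℝ) + 1) / r) := by
      field_simp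
    rw [h2]
    exact mul_nonpos_of_nonpos_of_nonneg (by linarith) (by positivity)
  obtain ⟨r, hr1, hr2⟩ := ((eventually_ge_atTop d).and
    (eventually_gt_atTop (φ d * d ^ ((N : ℝ) + 1) / (δ / N)))).exists
  have hr0 : 0 < r := ha.trans_le (hda.trans hr1)
  have h1 : φ r * r ^ ((N : ℝ) + 1) ≤ φ d * d ^ ((N : ℝ) + 1) := hdec Set.self_mem_Ici hr1 hr1
  have h2 := hlow r (hda.trans hr1)
  have h3 : r ^ (-(N : ℝ)) * r ^ ((N : ℝ) + 1) = r := by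
    rw [← Real.rpow_add hr0]
    simp
  have h4 : δ / N * r ≤ φ r * r ^ ((N : ℝ) + 1) := by
    calc δ / N * r = δ / N * r ^ (-(N : ℝ)) * r ^ ((N : ℝ) + 1) := by rw [mul_assoc, h3]
      _ ≤ _ := by gcongr
  rw [div_lt_iff₀ (by positivity)] at hr2
  linarith

/-- Exponential decay of a decaying positive solution and of its derivative. -/
theorem IsPositiveSolution.exists_exp_bound (hφ : IsPositiveSolution N γ α ω p φ)
    (hω : 0 < ω) (hα : 0 < α) (hN : 1 ≤ N) (hp : 1 < p)
    (hlim : Tendsto φ atTop (𝓝 0)) :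
    ∃ κ > 0, ∃ C, ∀ᶠ r in atTop,
      |φ r| ≤ C * Real.exp (-κ * r) ∧ |deriv φ r| ≤ C * Real.exp (-κ * r) := by
  have hN1 : (0 : ℝ) ≤ (N : ℝ) - 1 := by
    have : (1 : ℝ) ≤ N := by exact_mod_cast hN
    linarith
  have hcoef : Tendsto (fun r => γ / r ^ α + φ r ^ (p - 1)) atTop (𝓝 0) := by
    have h1 := (tendsto_rpow_neg_atTop hα).const_mul γ
    have h2 := ((Real.continuousAt_rpow_const 0 (p - 1) (Or.inr (by linarith))).tendsto.comp hlim)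
    rw [Real.zero_rpow (by linarith)] at h2
    have h3 := h1.add h2
    rw [mul_zero, add_zero] at h3
    refine h3.congr' ?_
    filter_upwards [eventually_gt_atTop 0] with r hr
    rw [Real.rpow_neg hr.le]
    rfl
  obtain ⟨a', ha'⟩ := eventually_atTop.1 (hcoef.eventually_le_const (half_pos hω))
  set a := max a' 1 with ha
  have ha0 : 0 < a := lt_max_of_lt_right one_pos
  have hq : ∀ r ≥ a, ω / 2 * φ r ≤ (ω - γ / r ^ α) * φ r - φ r ^ p := by
    intro r hr
    have h1 := ha' r ((le_max_left _ _).trans hr)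
    have h2 := hφ.pos r (ha0.le.trans hr)
    have h3 : φ r ^ p = φ r ^ (p - 1) * φ r := by
      rw [Real.rpow_sub_one h2.ne']; field_simp
    rw [h3]
    nlinarith
  have hfm : MonotoneOn (flux N φ) (Set.Ici a) :=
    monotoneOn_of_hasDerivAt_nonneg (convex_Ici a)
      (fun r hr => hφ.hasDerivAt_flux (ha0.trans_le hr)) (fun r hr => by
        have hr0 : 0 < r := ha0.trans_le hr
        have h1 := hφ.pos r hr0.le
        have h2 := hq r hr
        have h3 : 0 ≤ ω / 2 * φ r := by positivity
        exact mul_nonneg (Real.rpow_nonneg hr0.le _) (h3.trans h2))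
  have hneg : ∀ r ≥ a, deriv φ r < 0 := by
    intro r hr
    by_contra! h
    have hr0 : 0 < r := ha0.trans_le hr
    obtain ⟨s, hs, hds⟩ := hφ.exists_deriv_neg hlim hr0
    have h1 := hfm hr (le_trans hr hs) hs
    have h2 : 0 ≤ flux N φ r := mul_nonneg (Real.rpow_nonneg hr0.le _) h
    have h3 : flux N φ s < 0 :=
      mul_neg_of_pos_of_neg (Real.rpow_pos_of_pos (hr0.trans_le hs) _) hds
    linarith
  -- Here `φ'' ≥ (ω / 2) φ` and `φ' < 0`. A negative value of this energy would persist,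
  -- contradicting `φ → 0`, so `φ' ≤ -κ φ`.
  have hZ : AntitoneOn (fun r => deriv φ r ^ 2 - ω / 2 * φ r ^ 2) (Set.Ici a) := by
    refine antitoneOn_of_hasDerivAt_nonpos (convex_Ici a)
      (fun r hr => ((hφ.hasDerivAt_deriv (ha0.trans_le hr)).pow 2).sub
        (((hφ.hasDerivAt (ha0.trans_le hr)).pow 2).const_mul (ω / 2))) (fun r hr => ?_)
    have hr0 : 0 < r := ha0.trans_le hr
    have h1 := hneg r hr
    have h2 := hq r hr
    have h3 : 0 ≤ -(((N : ℝ) - 1) / r) * deriv φ r :=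
      mul_nonneg_of_nonpos_of_nonpos (neg_nonpos.2 (by positivity)) h1.le
    norm_num
    nlinarith
  set κ := √(ω / 2) with hκ
  have hκ0 : 0 < κ := Real.sqrt_pos.2 (half_pos hω)
  have hκ2 : κ ^ 2 = ω / 2 := Real.sq_sqrt (half_pos hω).le
  have hdle : ∀ r ≥ a, deriv φ r ≤ -(κ * φ r) := by
    intro r hr
    have h0 : 0 ≤ deriv φ r ^ 2 - ω / 2 * φ r ^ 2 := by
      by_contra! h
      have h1 : Tendsto (fun s => -(ω / 2 * φ s ^ 2)) atTop (𝓝 0) := by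
        simpa using ((hlim.pow 2).const_mul (ω / 2)).neg
      obtain ⟨s, hs1, hs2⟩ := ((eventually_ge_atTop r).and (h1.eventually_const_lt h)).exists
      have h3 := hZ hr (le_trans hr hs1) hs1
      simp only at h3
      nlinarith [sq_nonneg (deriv φ s)]
    have h1 := hneg r hr
    have h2 := hφ.pos r (ha0.le.trans hr)
    have h3 : κ * φ r ≤ -deriv φ r := by
      refine le_of_sq_le_sq ?_ (by linarith)
      rw [mul_pow, hκ2]
      linarith
    linarith
  have hexp : AntitoneOn (fun r => φ r * Real.exp (κ * r)) (Set.Ici a) := by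
    refine antitoneOn_of_hasDerivAt_nonpos (convex_Ici a)
      (fun r hr => (hφ.hasDerivAt (ha0.trans_le hr)).mul ((hasDerivAt_id r).const_mul κ).exp)
      (fun r hr => ?_)
    have h1 := hdle r hr
    have h2 := Real.exp_pos (κ * r)
    simp only [id]
    nlinarith
  set C := φ a * Real.exp (κ * a) with hC
  have hφC : ∀ r ≥ a, φ r ≤ C * Real.exp (-κ * r) := by
    intro r hr
    have h1 : φ r * Real.exp (κ * r) ≤ C := hexp Set.self_mem_Ici hr hr
    rw [neg_mul, Real.exp_neg, ← div_eq_mul_inv, le_div_iff₀ (Real.exp_pos _)]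
    exact h1
  have hC0 : 0 < C := mul_pos (hφ.pos a ha0.le) (Real.exp_pos _)
  refine ⟨κ, hκ0, C * Real.exp κ, ?_⟩
  filter_upwards [eventually_ge_atTop (a + 1)] with r hr
  have hra : a ≤ r := by linarith
  have hr0 : 0 < r := by linarith
  constructor
  · rw [abs_of_pos (hφ.pos r hr0.le)]
    refine (hφC r hra).trans ?_
    have : 1 ≤ Real.exp κ := Real.one_le_exp hκ0.le
    gcongr
    nlinarith
  -- Monotonicity of the flux gives `φ' s ≤ φ' r` on `[r - 1, r]`, hence `-φ' r ≤ φ (r - 1)`. The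
  -- unit shift accounts for the factor `exp κ`.
  · have h1 : AntitoneOn (fun s => φ s - deriv φ r * s) (Set.Icc (r - 1) r) := by
      refine antitoneOn_of_hasDerivAt_nonpos (convex_Icc _ _)
        (fun s hs => (hφ.hasDerivAt (by linarith [hs.1])).sub
          ((hasDerivAt_id s).const_mul (deriv φ r))) (fun s hs => ?_)
      have hs0 : 0 < s := by linarith [hs.1]
      have h2 : flux N φ s ≤ flux N φ r := hfm (by simp; linarith [hs.1]) hra hs.2
      have h3 : s ^ ((N : ℝ) - 1) ≤ r ^ ((N : ℝ) - 1) := Real.rpow_le_rpow hs0.le hs.2 hN1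
      have h4 : 0 < s ^ ((N : ℝ) - 1) := Real.rpow_pos_of_pos hs0 _
      have h5 := hneg r hra
      simp only [flux] at h2
      have h6 : s ^ ((N : ℝ) - 1) * deriv φ s ≤ s ^ ((N : ℝ) - 1) * deriv φ r := by nlinarith
      have h7 := le_of_mul_le_mul_left h6 h4
      linarith
    have h2 := h1 ⟨le_rfl, by linarith⟩ ⟨by linarith, le_rfl⟩ (by linarith : r - 1 ≤ r)
    have h3 := hφC (r - 1) (by linarith)
    have h4 := hφ.pos r hr0.le
    have h5 : C * Real.exp κ * Real.exp (-κ * r) = C * Real.exp (-κ * (r - 1)) := by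
      rw [mul_assoc, ← Real.exp_add]; ring_nf
    simp only at h2
    rw [h5, abs_of_neg (hneg r hra)]
    linarith

theorem tendsto_rpow_mul_mul_of_exp_bound {f g : ℝ → ℝ} {κ C : ℝ} (hκ : 0 < κ) (k : ℝ)
    (hf : ∀ᶠ r in atTop, |f r| ≤ C * Real.exp (-κ * r))
    (hg : ∀ᶠ r in atTop, |g r| ≤ C * Real.exp (-κ * r)) :
    Tendsto (fun r => r ^ k * (f r * g r)) atTop (𝓝 0) := by
  have h := (tendsto_rpow_mul_exp_neg_mul_atTop_nhds_zero k (2 * κ) (by positivity)).const_mul (C * C)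
  rw [mul_zero] at h
  refine squeeze_zero_norm' ?_ h
  filter_upwards [hf, hg, eventually_gt_atTop 0] with r h1 h2 hr
  rw [Real.norm_eq_abs, abs_mul, abs_mul, abs_of_pos (Real.rpow_pos_of_pos hr k)]
  calc r ^ k * (|f r| * |g r|)
      ≤ r ^ k * ((C * Real.exp (-κ * r)) * (C * Real.exp (-κ * r))) := by
        gcongr
        exact (abs_nonneg _).trans h1
    _ = C * C * (r ^ k * (Real.exp (-κ * r) * Real.exp (-κ * r))) := by ring
    _ = _ := by rw [← Real.exp_add]; ring_nf

/-! ### The generalized Pohožaev functional and its sign. -/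

/-- The coefficient `2 (N - 1) / (p + 3)` of the generalized Pohožaev identity. -/
noncomputable def pohozaevCoeff (N : ℕ) (p : ℝ) : ℝ := 2 * ((N : ℝ) - 1) / (p + 3)

/-- The exponent `2 (N - 1) (p + 1) / (p + 3)` of the generalized Pohožaev identity. -/
noncomputable def pohozaevExp (N : ℕ) (p : ℝ) : ℝ := pohozaevCoeff N p * (p + 1)

/-- The generalized Pohožaev functional. -/
noncomputable def pohozaev (N : ℕ) (γ α ω p : ℝ) (φ : ℝ → ℝ) (r : ℝ) : ℝ :=
  r ^ pohozaevExp N p * (deriv φ r ^ 2 / 2 + pohozaevCoeff N p / r * (φ r * deriv φ r)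
    + (pohozaevCoeff N p * (N - pohozaevExp N p) / r ^ 2 + γ / r ^ α - ω) / 2 * φ r ^ 2
    + φ r ^ (p + 1) / (p + 1))

/-- The sign-determining factor in the derivative of the generalized Pohožaev functional. -/
noncomputable def pohozaevDensity (N : ℕ) (γ α ω p r : ℝ) : ℝ :=
  pohozaevCoeff N p * (N - pohozaevExp N p) * (pohozaevExp N p - 2) / 2
    + r ^ 2 * (γ / r ^ α * (pohozaevCoeff N p * (p - 1) / 2 - α / 2)
      - ω * (pohozaevCoeff N p * (p - 1) / 2))

theorem pohozaevCoeff_mul (N : ℕ) (hp : 1 < p) :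
    pohozaevCoeff N p * (p + 3) = 2 * ((N : ℝ) - 1) := by
  rw [pohozaevCoeff, div_mul_cancel₀]
  linarith

theorem pohozaevCoeff_nonneg (hN : 1 ≤ N) (hp : 1 < p) : 0 ≤ pohozaevCoeff N p := by
  have : (1 : ℝ) ≤ N := by exact_mod_cast hN
  exact div_nonneg (by linarith) (by linarith)

theorem pohozaevExp_nonneg (hN : 1 ≤ N) (hp : 1 < p) : 0 ≤ pohozaevExp N p :=
  mul_nonneg (pohozaevCoeff_nonneg hN hp) (by linarith)

/-- With `m` the coefficient and `k` the exponent, the `φ'²` terms cancel when `k / 2 + m = N - 1`,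
the `φ^(p+1)` terms when `k = m (p + 1)`. These two equations determine `m` and `k`; the coefficient
`m (N - k)` then removes `φ φ'`. -/
theorem IsPositiveSolution.hasDerivAt_pohozaev (hφ : IsPositiveSolution N γ α ω p φ)
    (hp : 1 < p) {r : ℝ} (hr : 0 < r) :
    HasDerivAt (pohozaev N γ α ω p φ)
      (r ^ pohozaevExp N p / r ^ 3 * pohozaevDensity N γ α ω p r * φ r ^ 2) r := by
  have hm := pohozaevCoeff_mul N hp
  have hφr := hφ.pos r hr.le
  have hd := hφ.hasDerivAt hr
  have hdd := hφ.hasDerivAt_deriv hr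
  have hrα := Real.rpow_pos_of_pos hr α
  have hr' : r ≠ 0 := hr.ne'
  have hp1 : p + 1 ≠ 0 := by linarith
  have hinv : HasDerivAt (fun r => pohozaevCoeff N p / r) (-(pohozaevCoeff N p / r ^ 2)) r := by
    refine ((hasDerivAt_const r (pohozaevCoeff N p)).div (hasDerivAt_id r) hr').congr_deriv ?_
    simp [neg_div]
  have hinv2 : HasDerivAt (fun r => pohozaevCoeff N p * (N - pohozaevExp N p) / r ^ 2)
      (-(2 * (pohozaevCoeff N p * (N - pohozaevExp N p)) / r ^ 3)) r := by
    refine ((hasDerivAt_const r (pohozaevCoeff N p * (N - pohozaevExp N p))).div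
      (hasDerivAt_pow 2 r) (pow_ne_zero 2 hr')).congr_deriv ?_
    norm_num
    field_simp
  have hinvα : HasDerivAt (fun r => γ / r ^ α) (-(α * γ / (r ^ α * r))) r := by
    refine ((hasDerivAt_const r γ).div (hasDerivAt_rpow_div hr α) hrα.ne').congr_deriv ?_
    field_simp
    ring
  have hpow : HasDerivAt (fun r => φ r ^ (p + 1)) ((p + 1) * φ r ^ p * deriv φ r) r := by
    refine (hd.rpow_const (p := p + 1) (Or.inl hφr.ne')).congr_deriv ?_
    rw [add_sub_cancel_right]
    ring
  refine ((hasDerivAt_rpow_div hr (pohozaevExp N p)).mul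
    (((((hdd.pow 2).div_const 2).add (hinv.mul (hd.mul hdd))).add
      ((((hinv2.add hinvα).sub_const ω).div_const 2).mul (hd.pow 2))).add
      (hpow.div_const (p + 1)))).congr_deriv ?_
  -- Eliminating the dimension leaves an identity in free variables.
  have hN : (N : ℝ) = 1 + pohozaevCoeff N p * (p + 3) / 2 := by linarith
  simp only [Pi.mul_apply, Pi.add_apply, Pi.pow_apply, pohozaevDensity, Real.rpow_add_one hφr.ne']
  generalize r ^ pohozaevExp N p = a
  generalize hk : pohozaevExp N p = k
  rw [pohozaevExp] at hk
  rw [hN, ← hk]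
  generalize pohozaevCoeff N p = m
  generalize φ r ^ p = x
  generalize deriv φ r = y
  generalize φ r = z
  generalize r ^ α = b at *
  norm_num
  field_simp
  ring

theorem IsPositiveSolution.tendsto_pohozaev (hφ : IsPositiveSolution N γ α ω p φ)
    (hω : 0 < ω) (hα : 0 < α) (hN : 1 ≤ N) (hp : 1 < p)
    (hlim : Tendsto φ atTop (𝓝 0)) : Tendsto (pohozaev N γ α ω p φ) atTop (𝓝 0) := by
  obtain ⟨κ, hκ, C, hb⟩ := hφ.exists_exp_bound hω hα hN hp hlim
  have hb1 := hb.mono fun r h => h.1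
  have hb2 := hb.mono fun r h => h.2
  set k := pohozaevExp N p
  set m := pohozaevCoeff N p
  have h1 := tendsto_rpow_mul_mul_of_exp_bound hκ k hb2 hb2
  have h2 := tendsto_rpow_mul_mul_of_exp_bound hκ k hb1 hb2
  have h3 := tendsto_rpow_mul_mul_of_exp_bound hκ k hb1 hb1
  have h4 : Tendsto (fun r : ℝ => m / r) atTop (𝓝 0) := tendsto_const_nhds.div_atTop tendsto_id
  have h5 : Tendsto (fun r : ℝ => m * (N - k) / r ^ 2) atTop (𝓝 0) :=
    tendsto_const_nhds.div_atTop (tendsto_pow_atTop two_ne_zero)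
  have h6 : Tendsto (fun r : ℝ => γ / r ^ α) atTop (𝓝 0) :=
    tendsto_const_nhds.div_atTop (tendsto_rpow_atTop hα)
  have h7 : Tendsto (fun r => φ r ^ (p - 1)) atTop (𝓝 0) := by
    have := (Real.continuousAt_rpow_const 0 (p - 1) (Or.inr (by linarith))).tendsto.comp hlim
    rwa [Real.zero_rpow (by linarith)] at this
  have h := (((h1.div_const 2).add (h4.mul h2)).add
    ((((h5.add h6).sub_const ω).div_const 2).mul h3)).add ((h7.div_const (p + 1)).mul h3)
  simp only [zero_div, mul_zero, add_zero] at h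
  refine h.congr' ?_
  filter_upwards [eventually_gt_atTop 0] with r hr
  have hφr := hφ.pos r hr.le
  simp only [pohozaev, Real.rpow_add_one hφr.ne', Real.rpow_sub_one hφr.ne']
  field_simp
  ring

/-- Completing the square in the generalized Pohožaev functional. -/
theorem IsPositiveSolution.le_pohozaev (hφ : IsPositiveSolution N γ α ω p φ) (hp : 1 < p) {r : ℝ}
    (hr : 0 < r) :
    r ^ pohozaevExp N p * ((pohozaevCoeff N p * (N - pohozaevExp N p - pohozaevCoeff N p) / r ^ 2
      + γ / r ^ α - ω) / 2 * φ r ^ 2) ≤ pohozaev N γ α ω p φ r := by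
  rw [pohozaev]
  have hφr := hφ.pos r hr.le
  refine mul_le_mul_of_nonneg_left ?_ (Real.rpow_nonneg hr.le _)
  have h1 : 0 ≤ φ r ^ (p + 1) / (p + 1) :=
    div_nonneg (Real.rpow_nonneg hφr.le _) (by linarith)
  have h2 : 0 ≤ (deriv φ r + pohozaevCoeff N p / r * φ r) ^ 2 / 2 := by positivity
  have h3 : pohozaevCoeff N p * (N - pohozaevExp N p - pohozaevCoeff N p) / r ^ 2
      = pohozaevCoeff N p * (N - pohozaevExp N p) / r ^ 2 - (pohozaevCoeff N p / r) ^ 2 := by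
    field_simp
  rw [h3]
  nlinarith

theorem IsPositiveSolution.pohozaev_nonneg_of_density_nonpos
    (hφ : IsPositiveSolution N γ α ω p φ)
    (hω : 0 < ω) (hα : 0 < α) (hN : 1 ≤ N) (hp : 1 < p)
    (hlim : Tendsto φ atTop (𝓝 0)) {r : ℝ} (hr : 0 < r)
    (h : ∀ s ≥ r, pohozaevDensity N γ α ω p s ≤ 0) : 0 ≤ pohozaev N γ α ω p φ r := by
  have hanti : AntitoneOn (pohozaev N γ α ω p φ) (Set.Ici r) :=
    antitoneOn_of_hasDerivAt_nonpos (convex_Ici r)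
      (fun s hs => hφ.hasDerivAt_pohozaev hp (hr.trans_le hs)) (fun s hs => by
        have hs0 : 0 < s := hr.trans_le hs
        exact mul_nonpos_of_nonpos_of_nonneg
          (mul_nonpos_of_nonneg_of_nonpos (by positivity) (h s hs)) (sq_nonneg _))
  refine le_of_tendsto (hφ.tendsto_pohozaev hω hα hN hp hlim) ?_
  filter_upwards [eventually_ge_atTop r] with s hs using hanti Set.self_mem_Ici hs hs

/-- Near the origin the functional is asymptotically nonnegative when the exponent exceeds `2`. -/
theorem IsPositiveSolution.pohozaev_nonneg_of_density_nonneg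
    (hφ : IsPositiveSolution N γ α ω p φ) (hγ : 0 < γ) (hp : 1 < p)
    (hk : 2 < pohozaevExp N p) {r : ℝ} (hr : 0 < r)
    (h : ∀ s ∈ Set.Ioc 0 r, 0 ≤ pohozaevDensity N γ α ω p s) : 0 ≤ pohozaev N γ α ω p φ r := by
  have hmono : MonotoneOn (pohozaev N γ α ω p φ) (Set.Ioc 0 r) :=
    monotoneOn_of_hasDerivAt_nonneg (convex_Ioc 0 r)
      (fun s hs => hφ.hasDerivAt_pohozaev hp hs.1) (fun s hs => by
        have hs0 : 0 < s := hs.1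
        have := h s hs
        positivity)
  set k := pohozaevExp N p with hkdef
  set m := pohozaevCoeff N p
  have hlim : Tendsto (fun s => (m * (N - k - m) * s ^ (k - 2) - ω * s ^ k) / 2 * φ s ^ 2)
      (𝓝[>] 0) (𝓝 0) := by
    have := ((((tendsto_rpow_nhdsGT_zero (by linarith : 0 < k - 2)).const_mul (m * (N - k - m))).sub
      ((tendsto_rpow_nhdsGT_zero (by linarith : 0 < k)).const_mul ω)).div_const 2).mul (hφ.tendsto_zero.pow 2)
    simpa using this
  refine le_of_tendsto hlim ?_
  filter_upwards [Ioc_mem_nhdsGT hr] with s hs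
  have hs0 : 0 < s := hs.1
  refine le_trans ?_ ((hφ.le_pohozaev hp hs0).trans (hmono hs ⟨hr, le_rfl⟩ hs.2))
  rw [← hkdef, Real.rpow_sub hs0, Real.rpow_two]
  have h1 : 0 ≤ s ^ k * (γ / s ^ α / 2 * φ s ^ 2) := by positivity
  have h2 : s ^ k * ((m * (N - k - m) / s ^ 2 + γ / s ^ α - ω) / 2 * φ s ^ 2)
      = (m * (N - k - m) * (s ^ k / s ^ 2) - ω * s ^ k) / 2 * φ s ^ 2
        + s ^ k * (γ / s ^ α / 2 * φ s ^ 2) := by ring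
  rw [h2]
  linarith

/-- After clearing denominators the inequality reads `(N - 2) p < N + 2`, which is exactly
subcriticality. -/
theorem pohozaevExp_lt (hN : 1 ≤ N) (hp : 1 < p) (hsub : (p : EReal) < sobolevExponent N - 1) :
    pohozaevExp N p < N := by
  rw [pohozaevExp, pohozaevCoeff, div_mul_eq_mul_div, div_lt_iff₀ (by linarith)]
  have hN1 : (1 : ℝ) ≤ N := by exact_mod_cast hN
  rw [sobolevExponent] at hsub
  split_ifs at hsub with h2
  · have : (N : ℝ) ≤ 2 := by exact_mod_cast h2
    nlinarith
  · have h3 : (0 : ℝ) < (N : ℝ) - 2 := by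
      have : (3 : ℝ) ≤ N := by exact_mod_cast (not_le.1 h2)
      linarith
    have h4 : p < 2 * (N : ℝ) / (N - 2) - 1 := by exact_mod_cast hsub
    have h5 : p + 1 < 2 * (N : ℝ) / (N - 2) := by linarith
    rw [lt_div_iff₀ h3] at h5
    nlinarith

/-- If the density is nonpositive beyond `r`, `J` decreases to its limit 0. Otherwise it is positive
at some `s ≥ r`. For `N ≥ 3` it is then nonnegative on `(0, r]`, and `J` increases from a
nonnegative start. For `N ≤ 2` positivity at `s` forces `ω ≤ γ / r^α`, and completing the square
suffices. -/
theorem IsPositiveSolution.pohozaev_nonneg (hφ : IsPositiveSolution N γ α ω p φ)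
    (hω : 0 < ω) (hγ : 0 < γ) (hα : 0 < α) (hα2 : α < 2) (hN : 1 ≤ N) (hp : 1 < p)
    (hsub : (p : EReal) < sobolevExponent N - 1)
    (hlim : Tendsto φ atTop (𝓝 0)) {r : ℝ} (hr : 0 < r) : 0 ≤ pohozaev N γ α ω p φ r := by
  by_cases hall : ∀ s ≥ r, pohozaevDensity N γ α ω p s ≤ 0
  · exact hφ.pohozaev_nonneg_of_density_nonpos hω hα hN hp hlim hr hall
  push Not at hall
  obtain ⟨s, hrs, hs⟩ := hall
  have hs0 : 0 < s := hr.trans_le hrs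
  have hkN := pohozaevExp_lt hN hp hsub
  have hm0 := pohozaevCoeff_nonneg hN hp
  have hmp := pohozaevCoeff_mul N hp
  have hmk : pohozaevExp N p = pohozaevCoeff N p * (p + 1) := rfl
  rcases Nat.lt_or_ge 2 N with hN3 | hN2
  · have hN3' : (3 : ℝ) ≤ N := by exact_mod_cast hN3
    have hk2 : 2 < pohozaevExp N p := by
      have h1 : pohozaevExp N p * (p + 3) = 2 * ((N : ℝ) - 1) * (p + 1) := by
        rw [hmk, ← hmp]; ring
      nlinarith
    refine hφ.pohozaev_nonneg_of_density_nonneg hγ hp hk2 hr (fun t ht => ?_)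
    have hts : t ≤ s := ht.2.trans hrs
    have ht0 : 0 < t := ht.1
    rw [pohozaevDensity] at hs ⊢
    have hA : 0 ≤ pohozaevCoeff N p * (N - pohozaevExp N p) * (pohozaevExp N p - 2) / 2 := by
      have h1 : 0 ≤ (N : ℝ) - pohozaevExp N p := by linarith
      have h2 : 0 ≤ pohozaevExp N p - 2 := by linarith
      positivity
    set A := pohozaevCoeff N p * (N - pohozaevExp N p) * (pohozaevExp N p - 2) / 2
    set c := pohozaevCoeff N p * (p - 1) / 2 with hc
    have hc0 : 0 ≤ c := by
      have : 0 ≤ p - 1 := by linarith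
      positivity
    have hform : ∀ x : ℝ, 0 < x → x ^ 2 * (γ / x ^ α * (c - α / 2) - ω * c)
        = x ^ (2 - α) * (γ * (c - α / 2) - ω * c * x ^ α) := by
      intro x hx
      have := Real.rpow_pos_of_pos hx α
      rw [Real.rpow_sub hx, Real.rpow_two]
      field_simp
    rw [hform s hs0] at hs
    rw [hform t ht0]
    have hpowα : ω * c * t ^ α ≤ ω * c * s ^ α := by gcongr
    have hpow2 : t ^ (2 - α) ≤ s ^ (2 - α) := Real.rpow_le_rpow ht0.le hts (by linarith)
    have ht2 := Real.rpow_pos_of_pos ht0 (2 - α)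
    -- The bracket is nonincreasing in the radius. If negative at `t`, it is no larger at `s` and
    -- carries a larger power there, so the density at `t` is at least the positive one at `s`.
    rcases le_or_gt 0 (γ * (c - α / 2) - ω * c * t ^ α) with h | h
    · positivity
    · nlinarith
  · have hN2' : (N : ℝ) ≤ 2 := by exact_mod_cast hN2
    have hN1' : (1 : ℝ) ≤ N := by exact_mod_cast hN
    have hk2 : pohozaevExp N p ≤ 2 := by
      have h1 : pohozaevExp N p * (p + 3) = 2 * ((N : ℝ) - 1) * (p + 1) := by
        rw [hmk, ← hmp]; ring
      nlinarith
    have hm1 : pohozaevCoeff N p ≤ N - pohozaevExp N p := by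
      have h1 : (N - pohozaevExp N p - pohozaevCoeff N p) * (p + 3)
          = ((2 - (N : ℝ)) * p + 4 - N) := by
        linear_combination (-(p + 3)) * hmk - (p + 2) * hmp
      by_contra! hcon
      have h2 : (N - pohozaevExp N p - pohozaevCoeff N p) * (p + 3) < 0 :=
        mul_neg_of_neg_of_pos (by linarith) (by linarith)
      nlinarith
    refine le_trans ?_ (hφ.le_pohozaev hp hr)
    have hγω : ω * r ^ α ≤ γ := by
      rw [pohozaevDensity] at hs
      have hA : pohozaevCoeff N p * (N - pohozaevExp N p) * (pohozaevExp N p - 2) / 2 ≤ 0 := by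
        have h1 : 0 ≤ (N : ℝ) - pohozaevExp N p := by linarith
        have := mul_nonneg hm0 h1
        nlinarith
      have hc0 : 0 ≤ pohozaevCoeff N p * (p - 1) / 2 := by
        have : 0 ≤ p - 1 := by linarith
        positivity
      set c := pohozaevCoeff N p * (p - 1) / 2 with hc
      have hsα := Real.rpow_pos_of_pos hs0 α
      have h1 : 0 < s ^ 2 * (γ / s ^ α * (c - α / 2) - ω * c) := by linarith
      have h2 := pos_of_mul_pos_right h1 (sq_nonneg s)
      have h3 : 0 < γ * (c - α / 2) - ω * c * s ^ α := by
        have : γ * (c - α / 2) - ω * c * s ^ α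
            = (γ / s ^ α * (c - α / 2) - ω * c) * s ^ α := by field_simp
        rw [this]
        positivity
      have h4 : 0 < (γ - ω * s ^ α) * c := by nlinarith [mul_pos hγ hα]
      have h5 := pos_of_mul_pos_left h4 hc0
      have h6 : r ^ α ≤ s ^ α := Real.rpow_le_rpow hr.le hrs hα.le
      nlinarith
    have hrα := Real.rpow_pos_of_pos hr α
    have h1 : ω ≤ γ / r ^ α := by rwa [le_div_iff₀ hrα]
    have h2 : 0 ≤ pohozaevCoeff N p * (N - pohozaevExp N p - pohozaevCoeff N p) / r ^ 2 :=
      div_nonneg (mul_nonneg hm0 (by linarith)) (sq_nonneg r)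
    have h3 : 0 ≤ pohozaevCoeff N p * (N - pohozaevExp N p - pohozaevCoeff N p) / r ^ 2
        + γ / r ^ α - ω := by linarith
    positivity

/-! ### The comparison functional and monotonicity of the ratio. -/

/-- The comparison functional `(ψ / φ)² J[φ] - J[ψ]`. -/
noncomputable def comparison (N : ℕ) (γ α ω p : ℝ) (φ ψ : ℝ → ℝ) (r : ℝ) : ℝ :=
  (ψ r / φ r) ^ 2 * pohozaev N γ α ω p φ r - pohozaev N γ α ω p ψ r

/-- Both `J'` are the same radial factor times the square of the solution, so multiplying by `(ψ /
φ)²` makes them cancel. -/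
theorem IsPositiveSolution.hasDerivAt_comparison (hφ : IsPositiveSolution N γ α ω p φ)
    (hψ : IsPositiveSolution N γ α ω p ψ) (hp : 1 < p) {r : ℝ} (hr : 0 < r) :
    HasDerivAt (comparison N γ α ω p φ ψ)
      (2 * (ψ r / φ r) * (wronskian N φ ψ r / (r ^ ((N : ℝ) - 1) * φ r ^ 2))
        * pohozaev N γ α ω p φ r) r := by
  refine ((((hφ.hasDerivAt_div hψ hr).pow 2).mul (hφ.hasDerivAt_pohozaev hp hr)).sub
    (hψ.hasDerivAt_pohozaev hp hr)).congr_deriv ?_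
  have hφr := (hφ.pos r hr.le).ne'
  have h1 : (ψ r / φ r) ^ 2 * (r ^ pohozaevExp N p / r ^ 3 * pohozaevDensity N γ α ω p r * φ r ^ 2)
      = r ^ pohozaevExp N p / r ^ 3 * pohozaevDensity N γ α ω p r * ψ r ^ 2 := by
    field_simp
  simp only [Pi.pow_apply]
  rw [h1]
  norm_num

/-- The quadratic zeroth-order terms cancel in the comparison functional. -/
theorem IsPositiveSolution.comparison_eq (hφ : IsPositiveSolution N γ α ω p φ)
    (hψ : IsPositiveSolution N γ α ω p ψ) {r : ℝ} (hr : 0 < r) :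
    comparison N γ α ω p φ ψ r = r ^ pohozaevExp N p *
      (-(wronskian N φ ψ r / (r ^ ((N : ℝ) - 1) * φ r)) *
        ((ψ r / φ r * deriv φ r + deriv ψ r) / 2 + pohozaevCoeff N p / r * ψ r)
        + ψ r ^ 2 * (φ r ^ (p - 1) - ψ r ^ (p - 1)) / (p + 1)) := by
  have hφr := hφ.pos r hr.le
  have hψr := hψ.pos r hr.le
  have h1 := (Real.rpow_pos_of_pos hr ((N : ℝ) - 1)).ne'
  simp only [comparison, pohozaev, wronskian, flux, Real.rpow_add_one hφr.ne',
    Real.rpow_add_one hψr.ne', Real.rpow_sub_one hφr.ne', Real.rpow_sub_one hψr.ne']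
  field_simp
  ring

/-- Cancellation of the singular potential improves the order `r^(N-α)` of the separate fluxes to
`r^N`. -/
theorem IsPositiveSolution.exists_wronskian_bound (hφ : IsPositiveSolution N γ α ω p φ)
    (hψ : IsPositiveSolution N γ α ω p ψ) (hφ0 : RegularAtZero N φ) (hψ0 : RegularAtZero N ψ)
    (hγ : 0 < γ) (hα : 0 < α) (hαN : α < N) (hp : 1 < p) :
    ∃ K ≥ 0, ∀ r ∈ Set.Ioc (0 : ℝ) 1, |wronskian N φ ψ r| ≤ K * r ^ (N : ℝ) := by
  have hcont : ContinuousOn (fun r => φ r ^ p * ψ r - ψ r ^ p * φ r) (Set.Icc 0 1) := by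
    have h1 := hφ.continuousOn.mono fun r (hr : r ∈ Set.Icc (0 : ℝ) 1) => hr.1
    have h2 := hψ.continuousOn.mono fun r (hr : r ∈ Set.Icc (0 : ℝ) 1) => hr.1
    have hp0 : 0 ≤ p := by linarith
    exact ((h1.rpow_const fun _ _ => Or.inr hp0).mul h2).sub
      ((h2.rpow_const fun _ _ => Or.inr hp0).mul h1)
  obtain ⟨C, hC⟩ := isCompact_Icc.exists_bound_of_continuousOn hcont
  have hC0 : 0 ≤ C := (norm_nonneg _).trans (hC 0 ⟨le_rfl, zero_le_one⟩)
  have hN0 : (0 : ℝ) < N := hα.trans hαN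
  have hlim := frequently_lt_of_tendsto_zero (hφ.tendsto_wronskian hψ hφ0 hψ0 hγ hα hαN hp)
  refine ⟨C / N, by positivity, abs_le_rpow_of_hasDerivAt_le hN0 hC0
    (fun r hr => hφ.hasDerivAt_wronskian hψ hr.1) (fun r hr => ?_) hlim.1 hlim.2⟩
  have h1 := Real.rpow_pos_of_pos hr.1 ((N : ℝ) - 1)
  rw [abs_mul, abs_of_pos h1, mul_comm]
  exact mul_le_mul_of_nonneg_right (hC r ⟨hr.1.le, hr.2⟩) h1.le

/-- If `φ(0) < ψ(0)`, the comparison functional is asymptotically nonpositive at the origin. -/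
theorem IsPositiveSolution.exists_comparison_le (hφ : IsPositiveSolution N γ α ω p φ)
    (hψ : IsPositiveSolution N γ α ω p ψ) (hφ0 : RegularAtZero N φ) (hψ0 : RegularAtZero N ψ)
    (hγ : 0 < γ) (hα : 0 < α) (hα2 : α < 2) (hαN : α < N) (hN : 1 ≤ N) (hp : 1 < p)
    (hlt : φ 0 < ψ 0) :
    ∃ Y : ℝ → ℝ, Tendsto Y (𝓝[>] 0) (𝓝 0) ∧
      ∀ᶠ r in 𝓝[>] (0 : ℝ), comparison N γ α ω p φ ψ r ≤ Y r := by
  obtain ⟨K, hK, hKb⟩ := hφ.exists_wronskian_bound hψ hφ0 hψ0 hγ hα hαN hp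
  obtain ⟨K₁, hK₁, hK₁b⟩ := hφ.exists_deriv_bound hφ0 hγ hα hαN hp
  obtain ⟨K₂, hK₂, hK₂b⟩ := hψ.exists_deriv_bound hψ0 hγ hα hαN hp
  obtain ⟨C, hC, hCb⟩ := hψ.exists_bound 1
  obtain ⟨c, hc, hcb⟩ := hφ.exists_pos_bound zero_le_one
  have hm := pohozaevCoeff_nonneg hN hp
  have hk := pohozaevExp_nonneg hN hp
  set k := pohozaevExp N p with hkdef
  set m := pohozaevCoeff N p with hmdef
  refine ⟨fun r => K / c * ((C / c * K₁ + K₂) / 2) * r ^ (k + (2 - α)) + K / c * C * (m * r ^ k),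
    ?_, ?_⟩
  · have h1 := (tendsto_rpow_nhdsGT_zero (by linarith : 0 < k + (2 - α))).const_mul
      (K / c * ((C / c * K₁ + K₂) / 2))
    have h2 : Tendsto (fun r : ℝ => m * r ^ k) (𝓝[>] 0) (𝓝 0) := by
      -- The power `r ^ k` fails to vanish at 0 only if `k = 0`, and then `m = 0` as well.
      rcases hm.eq_or_lt with h | h
      · simp [← h]
      · have hk0 : 0 < k := mul_pos h (by linarith)
        simpa using (tendsto_rpow_nhdsGT_zero hk0).const_mul m
    simpa using h1.add (h2.const_mul (K / c * C))
  · filter_upwards [Ioc_mem_nhdsGT one_pos, hφ.tendsto_zero.eventually_lt hψ.tendsto_zero hlt]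
      with r hr hrlt
    have hr0 := hr.1
    have hr' : r ∈ Set.Icc (0 : ℝ) 1 := ⟨hr0.le, hr.2⟩
    have hφr := hφ.pos r hr0.le
    have hψr := hψ.pos r hr0.le
    have hcφ := hcb r hr'
    have hψC := hCb r hr'
    have hrN := Real.rpow_pos_of_pos hr0 ((N : ℝ) - 1)
    rw [hφ.comparison_eq hψ hr0]
    have hV : |-(wronskian N φ ψ r / (r ^ ((N : ℝ) - 1) * φ r))| ≤ K / c * r := by
      rw [abs_neg, abs_div, abs_of_pos (mul_pos hrN hφr)]
      calc |wronskian N φ ψ r| / (r ^ ((N : ℝ) - 1) * φ r)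
          ≤ K * r ^ (N : ℝ) / (r ^ ((N : ℝ) - 1) * c) := by
            gcongr
            exact hKb r hr
        _ = K / c * r := by
            rw [Real.rpow_sub_one hr0.ne']
            have := (Real.rpow_pos_of_pos hr0 (N : ℝ)).ne'
            field_simp
    have hS : |(ψ r / φ r * deriv φ r + deriv ψ r) / 2 + m / r * ψ r|
        ≤ (C / c * K₁ + K₂) / 2 * r ^ (1 - α) + m / r * C := by
      have hw : ψ r / φ r ≤ C / c := by gcongr
      have h1 : |ψ r / φ r * deriv φ r| ≤ C / c * (K₁ * r ^ (1 - α)) := by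
        rw [abs_mul, abs_of_pos (div_pos hψr hφr)]
        gcongr
        exact hK₁b r hr
      have h2 := hK₂b r hr
      have h3 : |m / r * ψ r| ≤ m / r * C := by
        rw [abs_of_nonneg (by positivity)]
        gcongr
      calc _ ≤ |(ψ r / φ r * deriv φ r + deriv ψ r) / 2| + |m / r * ψ r| := abs_add_le _ _
        _ ≤ (|ψ r / φ r * deriv φ r| + |deriv ψ r|) / 2 + |m / r * ψ r| := by
            rw [abs_div, abs_two]
            gcongr
            exact abs_add_le _ _
        _ ≤ _ := by linarith
    have hlast : ψ r ^ 2 * (φ r ^ (p - 1) - ψ r ^ (p - 1)) / (p + 1) ≤ 0 := by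
      have h1 : φ r ^ (p - 1) ≤ ψ r ^ (p - 1) :=
        Real.rpow_le_rpow hφr.le hrlt.le (by linarith)
      exact div_nonpos_of_nonpos_of_nonneg
        (mul_nonpos_of_nonneg_of_nonpos (sq_nonneg _) (by linarith)) (by linarith)
    have hprod := (le_abs_self _).trans ((abs_mul _ _).le.trans
      (mul_le_mul hV hS (abs_nonneg _) (by positivity)))
    have hrk := Real.rpow_pos_of_pos hr0 k
    calc _ ≤ r ^ k * (K / c * r * ((C / c * K₁ + K₂) / 2 * r ^ (1 - α) + m / r * C)) := by
          gcongr
          linarith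
      _ = _ := by
          rw [Real.rpow_add hr0, show (2 : ℝ) - α = 1 - α + 1 by ring, Real.rpow_add_one hr0.ne']
          field_simp

/-- A nonincreasing comparison functional is nonpositive. -/
theorem comparison_nonpos_of_antitoneOn {X Y : ℝ → ℝ} {b : ℝ} (hb : 0 < b)
    (hY : Tendsto Y (𝓝[>] 0) (𝓝 0)) (hXY : ∀ᶠ r in 𝓝[>] (0 : ℝ), X r ≤ Y r)
    (hX : AntitoneOn X (Set.Ioc 0 b)) : X b ≤ 0 := by
  refine ge_of_tendsto hY ?_
  filter_upwards [hXY, Ioc_mem_nhdsGT hb] with r h1 h2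
  exact (hX h2 ⟨hb, le_rfl⟩ h2.2).trans h1

/-- The ratio of two solutions with `φ(0) < ψ(0)` is strictly decreasing. -/
theorem IsPositiveSolution.wronskian_neg (hφ : IsPositiveSolution N γ α ω p φ)
    (hψ : IsPositiveSolution N γ α ω p ψ) (hφ0 : RegularAtZero N φ) (hψ0 : RegularAtZero N ψ)
    (hγ : 0 < γ) (hα : 0 < α) (hα2 : α < 2) (hαN : α < N) (hN : 1 ≤ N) (hp : 1 < p)
    (hJ : ∀ r > 0, 0 ≤ pohozaev N γ α ω p φ r)
    (hlt : φ 0 < ψ 0) : ∀ r > 0, wronskian N φ ψ r < 0 := by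
  have hW' : ∀ r > 0, φ r < ψ r →
      r ^ ((N : ℝ) - 1) * (φ r ^ p * ψ r - ψ r ^ p * φ r) < 0 := by
    intro r hr h
    have hφr := hφ.pos r hr.le
    have hψr := hψ.pos r hr.le
    have h1 : φ r ^ (p - 1) < ψ r ^ (p - 1) := Real.rpow_lt_rpow hφr.le h (by linarith)
    have h2 : φ r ^ p * ψ r - ψ r ^ p * φ r
        = φ r * ψ r * (φ r ^ (p - 1) - ψ r ^ (p - 1)) := by
      rw [Real.rpow_sub_one hφr.ne', Real.rpow_sub_one hψr.ne']
      field_simp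
    rw [h2]
    exact mul_neg_of_pos_of_neg (Real.rpow_pos_of_pos hr _)
      (mul_neg_of_pos_of_neg (by positivity) (by linarith))
  obtain ⟨d, hd0, hd⟩ := mem_nhdsGT_iff_exists_Ioc_subset.1
    (hφ.tendsto_zero.eventually_lt hψ.tendsto_zero hlt)
  have hd0' : (0 : ℝ) < d := hd0
  have hWnear : ∀ r ∈ Set.Ioc 0 d, wronskian N φ ψ r < 0 := by
    have hanti : StrictAntiOn (wronskian N φ ψ) (Set.Ioc 0 d) := by
      refine strictAntiOn_of_deriv_neg (convex_Ioc 0 d)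
        (fun r hr => (hφ.hasDerivAt_wronskian hψ hr.1).continuousAt.continuousWithinAt)
        (fun r hr => ?_)
      have hr' := interior_subset hr
      rw [(hφ.hasDerivAt_wronskian hψ hr'.1).deriv]
      exact hW' r hr'.1 (hd hr')
    intro r hr
    have hr2 : r / 2 ∈ Set.Ioc 0 d := ⟨half_pos hr.1, by linarith [hr.1, hr.2]⟩
    refine (hanti hr2 hr (half_lt_self hr.1)).trans_le ?_
    refine ge_of_tendsto (hφ.tendsto_wronskian hψ hφ0 hψ0 hγ hα hαN hp) ?_
    filter_upwards [Ioc_mem_nhdsGT hr2.1] with s hs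
    exact hanti.antitoneOn ⟨hs.1, hs.2.trans hr2.2⟩ hr2 hs.2
  have hcont : ContinuousOn (wronskian N φ ψ) (Set.Ioi 0) := fun r hr =>
    (hφ.hasDerivAt_wronskian hψ hr).continuousAt.continuousWithinAt
  by_contra! hcon
  obtain ⟨b, hb0, hWb⟩ := hcon
  -- The first zero `s` of the Wronskian; before it the ratio is strictly decreasing.
  obtain ⟨s, ⟨⟨hds, hsb⟩, hWs⟩, hmin⟩ : ∃ s, IsLeast {r ∈ Set.Icc d b | 0 ≤ wronskian N φ ψ r} s := by
    have hsub : Set.Icc d b ⊆ Set.Ioi 0 := fun r hr => hd0'.trans_le hr.1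
    refine IsCompact.exists_isLeast ?_ ⟨b, ⟨?_, le_rfl⟩, hWb⟩
    · exact isCompact_Icc.of_isClosed_subset
        ((hcont.mono hsub).preimage_isClosed_of_isClosed isClosed_Icc isClosed_Ici)
        Set.inter_subset_left
    · by_contra! h
      exact absurd (hWnear b ⟨hb0, h.le⟩) (not_lt.2 hWb)
  have hs0 : 0 < s := hd0'.trans_le hds
  have hWlt : ∀ r ∈ Set.Ioo 0 s, wronskian N φ ψ r < 0 := by
    intro r hr
    rcases le_or_gt r d with h | h
    · exact hWnear r ⟨hr.1, h⟩
    · by_contra! h'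
      exact absurd (hmin ⟨⟨h.le, hr.2.le.trans hsb⟩, h'⟩) (not_le.2 hr.2)
  have hWs0 : wronskian N φ ψ s = 0 := by
    refine le_antisymm ?_ hWs
    refine le_of_tendsto ((hφ.hasDerivAt_wronskian hψ hs0).continuousAt.tendsto.mono_left
      (nhdsWithin_le_nhds (s := Set.Iio s))) ?_
    filter_upwards [Ioo_mem_nhdsLT hs0] with r hr using (hWlt r hr).le
  have hWle : ∀ r ∈ Set.Ioc 0 s, wronskian N φ ψ r ≤ 0 := fun r hr =>
    hr.2.eq_or_lt.elim (fun h => h ▸ hWs0.le) fun h => (hWlt r ⟨hr.1, h⟩).le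
  have hquot : ∀ r ∈ Set.Ioc 0 s, wronskian N φ ψ r / (r ^ ((N : ℝ) - 1) * φ r ^ 2) ≤ 0 :=
    fun r hr => div_nonpos_of_nonpos_of_nonneg (hWle r hr)
      (mul_nonneg (Real.rpow_nonneg hr.1.le _) (sq_nonneg _))
  have hXanti : AntitoneOn (comparison N γ α ω p φ ψ) (Set.Ioc 0 s) :=
    antitoneOn_of_hasDerivAt_nonpos (convex_Ioc 0 s)
      (fun r hr => hφ.hasDerivAt_comparison hψ hp hr.1) (fun r hr =>
        mul_nonpos_of_nonpos_of_nonneg (mul_nonpos_of_nonneg_of_nonpos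
          (by have := hφ.pos r hr.1.le; have := hψ.pos r hr.1.le; positivity)
          (hquot r hr)) (hJ r hr.1))
  obtain ⟨Y, hY, hXY⟩ := hφ.exists_comparison_le hψ hφ0 hψ0 hγ hα hα2 hαN hN hp hlt
  have hXs := comparison_nonpos_of_antitoneOn hs0 hY hXY hXanti
  have hφs := hφ.pos s hs0.le
  have hψs := hψ.pos s hs0.le
  -- At `s` only the nonlinear term of the comparison functional survives, so its nonpositivity
  -- orders the two solutions.
  have hle : φ s ≤ ψ s := by
    by_contra! h
    have h1 : ψ s ^ (p - 1) < φ s ^ (p - 1) := Real.rpow_lt_rpow hψs.le h (by linarith)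
    rw [hφ.comparison_eq hψ hs0, hWs0] at hXs
    simp only [zero_div, neg_zero, zero_mul, zero_add] at hXs
    have h2 : 0 < s ^ pohozaevExp N p * (ψ s ^ 2 * (φ s ^ (p - 1) - ψ s ^ (p - 1)) / (p + 1)) := by
      have h3 : 0 < φ s ^ (p - 1) - ψ s ^ (p - 1) := by linarith
      have h4 : 0 < p + 1 := by linarith
      positivity
    linarith
  have hwanti : StrictAntiOn (fun r => ψ r / φ r) (Set.Ioc 0 s) := by
    refine strictAntiOn_of_deriv_neg (convex_Ioc 0 s)
      (fun r hr => (hφ.hasDerivAt_div hψ hr.1).continuousAt.continuousWithinAt) (fun r hr => ?_)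
    rw [interior_Ioc] at hr
    rw [(hφ.hasDerivAt_div hψ hr.1).deriv]
    exact div_neg_of_neg_of_pos (hWlt r hr) (mul_pos (Real.rpow_pos_of_pos hr.1 _)
      (pow_pos (hφ.pos r hr.1.le) 2))
  -- The ratio decreases to a value at least 1, so it exceeds 1 before `s`. The Wronskian therefore
  -- keeps decreasing and cannot return to 0.
  have hWanti : StrictAntiOn (wronskian N φ ψ) (Set.Ioc 0 s) := by
    refine strictAntiOn_of_deriv_neg (convex_Ioc 0 s)
      (fun r hr => (hφ.hasDerivAt_wronskian hψ hr.1).continuousAt.continuousWithinAt)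
      (fun r hr => ?_)
    rw [interior_Ioc] at hr
    rw [(hφ.hasDerivAt_wronskian hψ hr.1).deriv]
    refine hW' r hr.1 ?_
    have h1 : ψ s / φ s < ψ r / φ r := hwanti ⟨hr.1, hr.2.le⟩ ⟨hs0, le_rfl⟩ hr.2
    have h2 : 1 ≤ ψ s / φ s := (one_le_div hφs).2 hle
    exact (one_lt_div (hφ.pos r hr.1.le)).1 (h2.trans_lt h1)
  have h1 := hWanti ⟨half_pos hs0, (half_lt_self hs0).le⟩ ⟨hs0, le_rfl⟩ (half_lt_self hs0)
  have h2 := hWlt (s / 2) ⟨half_pos hs0, half_lt_self hs0⟩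
  linarith

/-! ### Conclusion: equality of the values at the origin. -/

/-- Divided by `r²` the density tends to `-ω m (p - 1) / 2`, so vanishing forces `m = 0`; but then
its value at 1 is `-γ α / 2`. -/
theorem not_forall_pohozaevDensity_eq_zero (hω : 0 < ω) (hγ : 0 < γ) (hα : 0 < α)
    (hp : 1 < p) : ¬ ∀ r > 0, pohozaevDensity N γ α ω p r = 0 := by
  intro h
  set m := pohozaevCoeff N p with hm
  set A := m * (N - pohozaevExp N p) * (pohozaevExp N p - 2) / 2 with hA
  have h1 : Tendsto (fun r : ℝ => A / r ^ 2 + γ / r ^ α * (m * (p - 1) / 2 - α / 2)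
      - ω * (m * (p - 1) / 2)) atTop (𝓝 (0 + 0 * (m * (p - 1) / 2 - α / 2)
      - ω * (m * (p - 1) / 2))) :=
    ((tendsto_const_nhds.div_atTop (tendsto_pow_atTop two_ne_zero)).add
      ((tendsto_const_nhds.div_atTop (tendsto_rpow_atTop hα)).mul_const _)).sub_const _
  have h2 : Tendsto (fun r : ℝ => A / r ^ 2 + γ / r ^ α * (m * (p - 1) / 2 - α / 2)
      - ω * (m * (p - 1) / 2)) atTop (𝓝 0) := by
    refine tendsto_const_nhds.congr' ?_
    filter_upwards [eventually_gt_atTop 0] with r hr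
    have h3 := h r hr
    rw [pohozaevDensity, ← hm, ← hA] at h3
    have h4 : A / r ^ 2 + γ / r ^ α * (m * (p - 1) / 2 - α / 2) - ω * (m * (p - 1) / 2)
        = (A + r ^ 2 * (γ / r ^ α * (m * (p - 1) / 2 - α / 2) - ω * (m * (p - 1) / 2)))
          / r ^ 2 := by
      rw [add_div, mul_div_cancel_left₀ _ (pow_ne_zero 2 hr.ne')]
      ring
    rw [h4, h3, zero_div]
  have h3 := tendsto_nhds_unique h1 h2
  have hm0 : m = 0 := by
    have h4 : ω * (p - 1) * m = 0 := by linarith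
    have h5 : ω * (p - 1) ≠ 0 := mul_ne_zero hω.ne' (by linarith)
    exact (mul_eq_zero.1 h4).resolve_left h5
  have h4 := h 1 one_pos
  rw [pohozaevDensity, ← hm, hm0] at h4
  simp only [Real.one_rpow] at h4
  nlinarith [mul_pos hγ hα]

theorem IsPositiveSolution.not_lt_at_zero (hφ : IsPositiveSolution N γ α ω p φ)
    (hψ : IsPositiveSolution N γ α ω p ψ) (hφ0 : RegularAtZero N φ) (hψ0 : RegularAtZero N ψ)
    (hγ : 0 < γ) (hα : 0 < α) (hα2 : α < 2) (hαN : α < N) (hN : 1 ≤ N) (hp : 1 < p)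
    (hsub : (p : EReal) < sobolevExponent N - 1)
    (hφlim : Tendsto φ atTop (𝓝 0)) (hψlim : Tendsto ψ atTop (𝓝 0)) : ¬ φ 0 < ψ 0 := by
  intro hlt
  have hω := hφ.omega_pos hγ hα2 hαN hN hφlim
  have hJ : ∀ r > 0, 0 ≤ pohozaev N γ α ω p φ r := fun r hr =>
    hφ.pohozaev_nonneg hω hγ hα hα2 hN hp hsub hφlim hr
  have hW := hφ.wronskian_neg hψ hφ0 hψ0 hγ hα hα2 hαN hN hp hJ hlt
  have hquot : ∀ r > 0, wronskian N φ ψ r / (r ^ ((N : ℝ) - 1) * φ r ^ 2) < 0 :=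
    fun r hr => div_neg_of_neg_of_pos (hW r hr)
      (mul_pos (Real.rpow_pos_of_pos hr _) (pow_pos (hφ.pos r hr.le) 2))
  have hXanti : AntitoneOn (comparison N γ α ω p φ ψ) (Set.Ioi 0) :=
    antitoneOn_of_hasDerivAt_nonpos (convex_Ioi 0)
      (fun r hr => hφ.hasDerivAt_comparison hψ hp hr) (fun r hr =>
        mul_nonpos_of_nonpos_of_nonneg (mul_nonpos_of_nonneg_of_nonpos
          (by
            have hr' : (0 : ℝ) ≤ r := le_of_lt hr
            have := hφ.pos r hr'
            have := hψ.pos r hr'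
            positivity)
          (hquot r hr).le) (hJ r hr))
  have hwanti : AntitoneOn (fun r => ψ r / φ r) (Set.Ioi 0) :=
    antitoneOn_of_hasDerivAt_nonpos (convex_Ioi 0)
      (fun r hr => hφ.hasDerivAt_div hψ hr) (fun r hr => (hquot r hr).le)
  obtain ⟨Y, hY, hXY⟩ := hφ.exists_comparison_le hψ hφ0 hψ0 hγ hα hα2 hαN hN hp hlt
  -- The ratio is nonincreasing, hence bounded on `[1, ∞)`, so both terms inherit the decay of `J`.
  have hXlim : Tendsto (comparison N γ α ω p φ ψ) atTop (𝓝 0) := by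
    have h1 := hφ.tendsto_pohozaev hω hα hN hp hφlim
    have h2 := hψ.tendsto_pohozaev hω hα hN hp hψlim
    have h3 : Tendsto (fun r => (ψ r / φ r) ^ 2 * pohozaev N γ α ω p φ r) atTop (𝓝 0) := by
      have h4 := h1.norm.const_mul ((ψ 1 / φ 1) ^ 2)
      rw [norm_zero, mul_zero] at h4
      refine squeeze_zero_norm' ?_ h4
      filter_upwards [eventually_ge_atTop 1] with r hr
      have hr0 : (0 : ℝ) < r := by linarith
      have h5 : ψ r / φ r ≤ ψ 1 / φ 1 := hwanti (Set.mem_Ioi.2 one_pos) hr0 hr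
      have h6 : 0 < ψ r / φ r := div_pos (hψ.pos r hr0.le) (hφ.pos r hr0.le)
      rw [norm_mul, norm_pow, Real.norm_of_nonneg h6.le]
      gcongr
    have h7 := h3.sub h2
    rw [sub_zero] at h7
    exact h7
  have hXzero : ∀ r > 0, comparison N γ α ω p φ ψ r = 0 := by
    intro r hr
    refine le_antisymm ?_ ?_
    · exact comparison_nonpos_of_antitoneOn hr hY hXY (hXanti.mono fun s hs => hs.1)
    · refine le_of_tendsto hXlim ?_
      filter_upwards [eventually_ge_atTop r] with s hs
      exact hXanti hr (hr.trans_le hs : (0 : ℝ) < s) hs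
  have hzero : ∀ {f : ℝ → ℝ} {f' r : ℝ}, 0 < r → (∀ s > 0, f s = 0) → HasDerivAt f f' r →
      f' = 0 := by
    intro f f' r hr hf hd
    refine hd.unique ((hasDerivAt_const r (0 : ℝ)).congr_of_eventuallyEq ?_)
    filter_upwards [Ioi_mem_nhds hr] with s hs using hf s hs
  -- In `X' = 2 w w' J[φ] = 0` both `w` and `w'` are nonzero.
  have hJzero : ∀ r > 0, pohozaev N γ α ω p φ r = 0 := by
    intro r hr
    have h1 := hzero hr hXzero (hφ.hasDerivAt_comparison hψ hp hr)
    refine (mul_eq_zero.1 h1).resolve_left (mul_ne_zero ?_ (hquot r hr).ne)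
    have := hφ.pos r hr.le
    have := hψ.pos r hr.le
    positivity
  refine not_forall_pohozaevDensity_eq_zero (N := N) hω hγ hα hp fun r hr => ?_
  have h1 := hzero hr hJzero (hφ.hasDerivAt_pohozaev hp hr)
  have h2 := (mul_eq_zero.1 h1).resolve_right (pow_ne_zero 2 (hφ.pos r hr.le).ne')
  refine (mul_eq_zero.1 h2).resolve_left ?_
  positivity

theorem Assumptions.eq_of_isPositiveSolution (h : Assumptions N γ α ω p)
    (hφ : IsPositiveSolution N γ α ω p φ) (hψ : IsPositiveSolution N γ α ω p ψ)
    (hφ0 : RegularAtZero N φ) (hψ0 : RegularAtZero N ψ)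
    (hφlim : Tendsto φ atTop (𝓝 0)) (hψlim : Tendsto ψ atTop (𝓝 0)) :
    ∀ r : ℝ, 0 ≤ r → φ r = ψ r := by
  have hαN : α < N := h.alpha_lt.trans_le (min_le_left _ _)
  have hα2 : α < 2 := h.alpha_lt.trans_le (min_le_right _ _)
  refine hφ.eq_of_eq_zero hψ hφ0 hψ0 h.gamma_pos h.alpha_pos hαN h.one_lt_p h.one_le_N ?_
  exact le_antisymm
    (not_lt.1 (hψ.not_lt_at_zero hφ hψ0 hφ0 h.gamma_pos h.alpha_pos hα2 hαN h.one_le_N h.one_lt_p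
      h.p_lt hψlim hφlim))
    (not_lt.1 (hφ.not_lt_at_zero hψ hφ0 hψ0 h.gamma_pos h.alpha_pos hα2 hαN h.one_le_N h.one_lt_p
      h.p_lt hφlim hψlim))

end InversePowerNLS

theorem mainTheorem1 (N : ℕ) (γ α ω p : ℝ)
    (h : InversePowerNLS.Assumptions N γ α ω p) :
    (2 ≤ N → ∀ φ ψ : ℝ → ℝ,
      InversePowerNLS.IsPositiveSolution N γ α ω p φ →
      InversePowerNLS.IsPositiveSolution N γ α ω p ψ →
      Tendsto φ atTop (𝓝 0) → Tendsto ψ atTop (𝓝 0) →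
      ∀ r : ℝ, 0 ≤ r → φ r = ψ r) ∧
    (N = 1 → ∀ φ ψ : ℝ → ℝ,
      InversePowerNLS.IsPositiveSolution N γ α ω p φ →
      InversePowerNLS.IsPositiveSolution N γ α ω p ψ →
      Tendsto φ atTop (𝓝 0) → Tendsto ψ atTop (𝓝 0) →
      Tendsto (deriv φ) (𝓝[>] 0) (𝓝 0) → Tendsto (deriv ψ) (𝓝[>] 0) (𝓝 0) →
      ∀ r : ℝ, 0 ≤ r → φ r = ψ r) :=
  ⟨fun hN _ _ hφ hψ hφlim hψlim =>
    h.eq_of_isPositiveSolution hφ hψ (Or.inl hN) (Or.inl hN) hφlim hψlim,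
  fun hN _ _ hφ hψ hφlim hψlim hφ0 hψ0 =>
    h.eq_of_isPositiveSolution hφ hψ (Or.inr ⟨hN, hφ0⟩) (Or.inr ⟨hN, hψ0⟩) hφlim hψlim⟩
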